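/- Fix a non-degenerate triangle $\triangle$ in the plane with corners $\tau_1,\tau_2,\tau_3$ (indices modulo $3$) and angles $\theta_1\le\theta_2\le\theta_3=\pi-\theta_1-\theta_2$ at them. All point sets $S\subset\mathbb R^2$ are finite and in general position: no two points of $S$ lie on a line parallel to a side of $\triangle$. The $\mathrm{TD}_{\theta_1,\theta_2}$-Delaunay graph of $S$ joins two distinct points $u,v\in S$ by an edge, of length $|uv|$, when some scaled translate of $\triangle$ has $u,v$ on its boundary and no point of $S$ in its interior. Let $$C(\theta_1,\theta_2)=\max_{j\in\{1,2,3\},\,0\le\alpha\le\theta_j}\Bigl(\tfrac{\sin(\theta_j-\alpha)}{\sin\theta_{j+1}}+\tfrac{\sin\alpha}{\sin\theta_{j-1}}+\min\bigl(\tfrac{\sin\alpha}{\sin\theta_{j-1}}+\tfrac{\sin(\alpha+\theta_{j-1})}{\sin\theta_{j+1}},\ \tfrac{\sin(\theta_j-\alpha)}{\sin\theta_{j+1}}+\tfrac{\sin(\alpha+\theta_{j-1})}{\sin\theta_{j-1}}\bigr)\Bigr).$$ For a vertex $u$ of a graph, $N_k(u)$ is the set of vertices reachable from $u$ by at most $k$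 edges. A $k$-local routing algorithm repeatedly maps (current vertex $p$, $N_k(p)$, destination $t$, memory register) to a next vertex in $N_1(p)$ and new register contents, starting from a fixed initial register; it is memoryless if there is no register. It is $c$-competitive if for every $S$ as above and all $s,t\in S$ its path from $s$ reaches $t$ with length at most $c|st|$; its routing ratio is the least such $c$. For $u\ne v$ let $T^{u,v}$ be the smallest scaled translate of $\triangle$ with $u,v$ on its boundary, with corners $\tau^{u,v}_i$. Let $C_{p,i}=\{v: p=\tau_i^{p,v}\}$ (positive cones of $p$) and $\overline{C_{p,i}}=\{v: v=\tau_i^{p,v}\}$ (negative cones of $p$). The *cone algorithm* is the following $1$-local memoryless algorithm with current vertex $p\ne t$. If $t\in C_{p,i}$, follow the edge from $p$ in $C_{p,i}$. If $t\in\overline{C_{p,i}}$, write $\tau_l=\tau_l^{p,t}$, $X_j=C_{p,i+j}\cap T^{p,t}$ for $j=\pm1$, and $X_M=\overline{C_{p,i}}\cap T^{p,t}$; a region is called empty if it contains no neighbour of $p$. * If $X_1$ and $X_{-1}$ are empty, let $j\in\{1,-1\}$ minimise $|p\tau_{i+j}|+|\tau_{i+j}t|$ and go to the neighbour in $X_M$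 closest to $C_{p,i+j}$ in cyclic order about $p$. * If exactly one $X_j$ is empty, go to the neighbour in $X_M$ closest to $C_{p,i+j}$ in cyclic order about $p$, or, if $X_M$ is empty, to the neighbour in $X_{-j}$. * If neither is empty, go to an arbitrary neighbour in $X_M$; if $X_M$ is empty, let $j\in\{1,-1\}$ minimise $|p\tau_{i+j}|+|\tau_{i-j}t|$ and go to the neighbour in $X_{-j}$ (the side region at the corner $\tau_{i+j}$). **Theorem.** The routing ratio of $\mathrm{TD}_{\theta_1,\theta_2}$-Delaunay graphs is exactly $C(\theta_1,\theta_2)$: 1. The cone algorithm is well defined (a next vertex always exists), and however its ties and arbitrary choices are resolved, its routing ratio is exactly $C(\theta_1,\theta_2)$. More precisely, its path from $s$ to $t$ has length at most $C(\theta_1,\theta_2)\,|st|$ if $t$ is in a negative cone of $s$, and at most $|st|/\sin(\theta_1/2)$ if $t$ is in a positive cone of $s$. 2. For every $k\ge1$, every $k$-local routing algorithm, with any amount of memory, that is $c$-competitive satisfies $c\ge C(\theta_1,\theta_2)$. -/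

import Mathlib

/-- The Euclidean plane. -/
abbrev Plane : Type := EuclideanSpace ℝ (Fin 2)

namespace TDRouting

noncomputable section

/-! ### The constant `C(θ₁, θ₂)` -/

/-- The three angles `θ₁`, `θ₂`, `θ₃ = π - θ₁ - θ₂`, with indices modulo `3`
(the indices `1, 2, 3` are written `0, 1, 2 : Fin 3`; addition in `Fin 3` is modulo `3`). -/
def angles (θ₁ θ₂ : ℝ) : Fin 3 → ℝ := ![θ₁, θ₂, Real.pi - θ₁ - θ₂]

/-- The trigonometric expression that is maximised in the definition of `C(θ₁, θ₂)`. -/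
def detourRatio (θ : Fin 3 → ℝ) (j : Fin 3) (α : ℝ) : ℝ :=
  Real.sin (θ j - α) / Real.sin (θ (j + 1)) + Real.sin α / Real.sin (θ (j - 1)) +
    min (Real.sin α / Real.sin (θ (j - 1)) + Real.sin (α + θ (j - 1)) / Real.sin (θ (j + 1)))
      (Real.sin (θ j - α) / Real.sin (θ (j + 1)) +
        Real.sin (α + θ (j - 1)) / Real.sin (θ (j - 1)))

/-- All values of the expression, for `j` an index and `0 ≤ α ≤ θ_j`. -/
def detourValues (θ₁ θ₂ : ℝ) : Set ℝ :=
  {x | ∃ j : Fin 3, ∃ α ∈ Set.Icc 0 (angles θ₁ θ₂ j), x = detourRatio (angles θ₁ θ₂) j α}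

/-- The constant `C(θ₁, θ₂)`. The supremum is a maximum, see `isGreatest_routingConstant`. -/
def routingConstant (θ₁ θ₂ : ℝ) : ℝ := sSup (detourValues θ₁ θ₂)

theorem isGreatest_routingConstant {θ₁ θ₂ : ℝ} (h₁ : 0 < θ₁) :
    IsGreatest (detourValues θ₁ θ₂) (routingConstant θ₁ θ₂) := by
  have hv : detourValues θ₁ θ₂ =
      ⋃ j : Fin 3, detourRatio (angles θ₁ θ₂) j '' Set.Icc 0 (angles θ₁ θ₂ j) := by
    ext x
    simp only [detourValues, Set.mem_ofPred_eq, Set.mem_iUnion, Set.mem_image]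
    constructor
    · rintro ⟨j, α, hα, rfl⟩
      exact ⟨j, α, hα, rfl⟩
    · rintro ⟨j, α, hα, rfl⟩
      exact ⟨j, α, hα, rfl⟩
  have hc : IsCompact (detourValues θ₁ θ₂) := by
    rw [hv]
    refine isCompact_iUnion fun j => isCompact_Icc.image ?_
    unfold detourRatio
    fun_prop
  have hne : (detourValues θ₁ θ₂).Nonempty :=
    ⟨_, 0, 0, ⟨le_rfl, by simpa [angles] using h₁.le⟩, rfl⟩
  exact hc.isGreatest_sSup hne

/-! ### Scaled translates of the triangle and cones

Throughout, `τ : Fin 3 → Plane` lists the corners `τ₁, τ₂, τ₃` of the fixed triangle. -/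

/-- The corner corresponding to `τ i` of the translate by `x` of the triangle scaled by `r`. -/
def corner (τ : Fin 3 → Plane) (r : ℝ) (x : Plane) (i : Fin 3) : Plane := r • τ i + x

/-- The closed triangle `r • △ + x`. -/
def triangle (τ : Fin 3 → Plane) (r : ℝ) (x : Plane) : Set Plane :=
  convexHull ℝ (Set.range (corner τ r x))

/-- `r • △ + x` is the triangle `T^{u,v}`: the smallest scaled translate of `△` with `u` and `v`
on its boundary. -/
def IsSmallest (τ : Fin 3 → Plane) (u v : Plane) (r : ℝ) (x : Plane) : Prop :=
  (0 < r ∧ u ∈ frontier (triangle τ r x) ∧ v ∈ frontier (triangle τ r x)) ∧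
    ∀ (r' : ℝ) (x' : Plane), 0 < r' → u ∈ frontier (triangle τ r' x') →
      v ∈ frontier (triangle τ r' x') → r ≤ r'

/-- The positive cone `C_{p,i} = {v | p = τ_i^{p,v}}` (without its apex `p`). -/
def posCone (τ : Fin 3 → Plane) (p : Plane) (i : Fin 3) : Set Plane :=
  {v | ∃ (r : ℝ) (x : Plane), IsSmallest τ p v r x ∧ p = corner τ r x i}

/-- The negative cone at `p`, `{v | v = τ_i^{p,v}}` (without its apex `p`). -/
def negCone (τ : Fin 3 → Plane) (p : Plane) (i : Fin 3) : Set Plane :=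
  {v | ∃ (r : ℝ) (x : Plane), IsSmallest τ p v r x ∧ v = corner τ r x i}

/-! ### The graphs -/

/-- General position: no two points of `S` lie on a line parallel to a cone boundary, that is,
to a side of `△`. -/
def GeneralPosition (τ : Fin 3 → Plane) (S : Set Plane) : Prop :=
  ∀ u ∈ S, ∀ v ∈ S, u ≠ v → ∀ i j : Fin 3, i ≠ j → ∀ c : ℝ, v - u ≠ c • (τ j - τ i)

/-- The generalized TD-Delaunay graph of `S` with respect to the triangle `τ`: distinct points
`u, v` of `S` are adjacent when some scaled translate of the triangle has both of them on its
boundary and no point of `S` in its interior. -/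
def tdGraph (τ : Fin 3 → Plane) (S : Set Plane) : SimpleGraph Plane where
  Adj u v := u ≠ v ∧ u ∈ S ∧ v ∈ S ∧ ∃ (r : ℝ) (x : Plane), 0 < r ∧
    u ∈ frontier (triangle τ r x) ∧ v ∈ frontier (triangle τ r x) ∧
    ∀ w ∈ S, w ∉ interior (triangle τ r x)
  symm := ⟨by
    rintro u v ⟨h, hu, hv, r, x, hr, hu', hv', hw⟩
    exact ⟨h.symm, hv, hu, r, x, hr, hv', hu', hw⟩⟩
  loopless := ⟨fun _ h => h.1 rfl⟩

/-- The `k`-neighbourhood `N_k(u)`: all vertices reachable from `u` by at most `k` edges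
(so `u` belongs to it). -/
def nbhd (G : SimpleGraph Plane) (k : ℕ) (u : Plane) : Set Plane :=
  {v | ∃ w : G.Walk u v, w.length ≤ k}

/-! ### Local routing algorithms -/

/-- A local routing algorithm with a memory register whose contents range over `M`: in a round it
reads the current vertex, its `k`-neighbourhood, the destination and the register, and it outputs
the next vertex and the new contents of the register. It is memoryless when `M = Unit`. -/
structure RoutingAlgorithm (M : Type*) where
  init : M
  step : Plane → Set Plane → Plane → M → Plane × M

/-- The current vertex and the register after `n` rounds of routing from `s` to `t` in `G`, when
the algorithm is shown `k`-neighbourhoods. -/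
def RoutingAlgorithm.state {M : Type*} (A : RoutingAlgorithm M) (G : SimpleGraph Plane) (k : ℕ)
    (s t : Plane) : ℕ → Plane × M
  | 0 => (s, A.init)
  | n + 1 =>
    A.step (A.state G k s t n).1 (nbhd G k (A.state G k s t n).1) t (A.state G k s t n).2

/-- In `G`, the algorithm (shown `k`-neighbourhoods) leads from `s` to `t` in finitely many
rounds, each moving to a vertex of the `1`-neighbourhood of the current vertex, and the length of
its path is at most `L`. -/
def RoutingAlgorithm.RoutesWithin {M : Type*} (A : RoutingAlgorithm M) (G : SimpleGraph Plane)
    (k : ℕ) (s t : Plane) (L : ℝ) : Prop :=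
  ∃ n : ℕ, (A.state G k s t n).1 = t ∧
    (∀ i < n, (A.state G k s t (i + 1)).1 ∈ nbhd G 1 (A.state G k s t i).1) ∧
    ∑ i ∈ Finset.range n, dist (A.state G k s t i).1 (A.state G k s t (i + 1)).1 ≤ L

/-- The algorithm (shown `k`-neighbourhoods) is `c`-competitive for the TD-Delaunay graphs, with
respect to the triangle `τ`, of finite point sets in general position. The routing ratio of the
algorithm is the least such `c`. -/
def RoutingAlgorithm.IsCompetitive {M : Type*} (A : RoutingAlgorithm M) (τ : Fin 3 → Plane)
    (k : ℕ) (c : ℝ) : Prop :=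
  ∀ S : Set Plane, S.Finite → GeneralPosition τ S → ∀ s ∈ S, ∀ t ∈ S,
    A.RoutesWithin (tdGraph τ S) k s t (c * dist s t)

/-! ### The explicit algorithm -/

/-- For `t` in the negative cone of `p` with index `i`, and `T^{p,t} = r • △ + x`, the region
`C_{p,i+j} ∩ T^{p,t}`, used for `j = 1` and `j = -1`. -/
def sideRegion (τ : Fin 3 → Plane) (p : Plane) (r : ℝ) (x : Plane) (i j : Fin 3) : Set Plane :=
  posCone τ p (i + j) ∩ triangle τ r x

/-- The middle region: the negative cone of `p` with index `i`, intersected with `T^{p,t}`. -/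
def midRegion (τ : Fin 3 → Plane) (p : Plane) (r : ℝ) (x : Plane) (i : Fin 3) : Set Plane :=
  negCone τ p i ∩ triangle τ r x

/-- Among the points of `X`, a subset of the negative cone of `p` with index `i`, the point `v`
is closest to the adjacent cone `C_{p,i+j}` in cyclic order about `p` (`j = ±1`): it makes the
smallest angle with the ray from `p` in direction `τ_i - τ_{i+j}`, the common boundary of the
two cones. -/
def ClosestToSide (τ : Fin 3 → Plane) (p : Plane) (i j : Fin 3) (X : Set Plane) (v : Plane) :
    Prop :=
  v ∈ X ∧ ∀ w ∈ X, InnerProductGeometry.angle (v - p) (τ i - τ (i + j)) ≤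
    InnerProductGeometry.angle (w - p) (τ i - τ (i + j))

/-- One round of the explicit routing algorithm: at the vertex `p` with set of neighbours `N` and
destination `t`, the vertex `v` is a permitted next vertex. In all constructors except `posCase`,
`r • △ + x` is the triangle `T^{p,t}`. -/
inductive AlgStep (τ : Fin 3 → Plane) (p : Plane) (N : Set Plane) (t : Plane) :
    Plane → Prop
  /-- `t` is in a positive cone of `p`: follow the edge in this cone. -/
  | posCase (i : Fin 3) (v : Plane) (ht : t ∈ posCone τ p i) (hv : v ∈ N)
      (hvi : v ∈ posCone τ p i) : AlgStep τ p N t v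
  /-- `t` is in a negative cone and both side regions are empty: take the neighbour in the middle
  region closest to the side `j` that minimises `|p τ_{i+j}| + |τ_{i+j} t|`. -/
  | bothEmpty (i j : Fin 3) (r : ℝ) (x v : Plane) (hT : IsSmallest τ p t r x)
      (ht : t = corner τ r x i) (hj : j = 1 ∨ j = -1)
      (h₁ : N ∩ sideRegion τ p r x i 1 = ∅) (h₂ : N ∩ sideRegion τ p r x i (-1) = ∅)
      (hmin : dist p (corner τ r x (i + j)) + dist (corner τ r x (i + j)) t ≤
        dist p (corner τ r x (i - j)) + dist (corner τ r x (i - j)) t)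
      (hv : ClosestToSide τ p i j (N ∩ midRegion τ p r x i) v) : AlgStep τ p N t v
  /-- Only the side region `j` is empty and there are neighbours in the middle region: take the
  one closest to the empty region. -/
  | oneEmptyMid (i j : Fin 3) (r : ℝ) (x v : Plane) (hT : IsSmallest τ p t r x)
      (ht : t = corner τ r x i) (hj : j = 1 ∨ j = -1)
      (h₁ : N ∩ sideRegion τ p r x i j = ∅) (h₂ : (N ∩ sideRegion τ p r x i (-j)).Nonempty)
      (hv : ClosestToSide τ p i j (N ∩ midRegion τ p r x i) v) : AlgStep τ p N t v
  /-- Only the side region `j` is empty and there are no neighbours in the middle region: take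
  the neighbour in the non-empty side region. -/
  | oneEmptySide (i j : Fin 3) (r : ℝ) (x v : Plane) (hT : IsSmallest τ p t r x)
      (ht : t = corner τ r x i) (hj : j = 1 ∨ j = -1)
      (h₁ : N ∩ sideRegion τ p r x i j = ∅) (hM : N ∩ midRegion τ p r x i = ∅)
      (hv : v ∈ N ∩ sideRegion τ p r x i (-j)) : AlgStep τ p N t v
  /-- Neither side region is empty and there are neighbours in the middle region: take any of
  them. -/
  | noneEmptyMid (i : Fin 3) (r : ℝ) (x v : Plane) (hT : IsSmallest τ p t r x)
      (ht : t = corner τ r x i) (h₁ : (N ∩ sideRegion τ p r x i 1).Nonempty)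
      (h₂ : (N ∩ sideRegion τ p r x i (-1)).Nonempty)
      (hv : v ∈ N ∩ midRegion τ p r x i) : AlgStep τ p N t v
  /-- Neither side region is empty and there are no neighbours in the middle region: for the `j`
  that minimises `|p τ_{i+j}| + |τ_{i-j} t|`, take the neighbour in the side region that contains
  the corner `τ_{i+j}` of `T^{p,t}`, which is the one in `C_{p,i-j}`. -/
  | noneEmptySide (i j : Fin 3) (r : ℝ) (x v : Plane) (hT : IsSmallest τ p t r x)
      (ht : t = corner τ r x i) (hj : j = 1 ∨ j = -1)
      (h₁ : (N ∩ sideRegion τ p r x i j).Nonempty)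
      (hM : N ∩ midRegion τ p r x i = ∅)
      (hmin : dist p (corner τ r x (i + j)) + dist (corner τ r x (i - j)) t ≤
        dist p (corner τ r x (i - j)) + dist (corner τ r x (i + j)) t)
      (hv : v ∈ N ∩ sideRegion τ p r x i (-j)) : AlgStep τ p N t v

/-- The memoryless algorithm `A`, shown `1`-neighbourhoods, is an implementation of the explicit
algorithm (with some way of breaking ties and of making its arbitrary choices). -/
def RoutingAlgorithm.Implements (A : RoutingAlgorithm Unit) (τ : Fin 3 → Plane) : Prop :=
  ∀ S : Set Plane, S.Finite → GeneralPosition τ S → ∀ p ∈ S, ∀ t ∈ S, p ≠ t →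
    AlgStep τ p (nbhd (tdGraph τ S) 1 p \ {p}) t
      (A.step p (nbhd (tdGraph τ S) 1 p) t ()).1

end

end TDRouting

namespace TDRouting

/-! ### Barycentric coordinates with respect to the triangle -/

/-! Everything is read in barycentric coordinates with respect to the triangle. A scaled translate
is cut out by lower bounds on the three coordinates, `T^{u,v}` has the coordinatewise minima as
bounds (`isSmallest_iff`), and the cones of `p` record which coordinates grow. An edge means that no
point exceeds both ends' minimum in all coordinates (`tdGraph_adj_iff`).

Upper bound. `Good` is a potential: the length of a walk along sides of `T^{p,t}`, with corners
`τ_l`, that bounds what remains of the path. If `t = τ_i` is in a negative cone and nothing is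
known, the walk is `p → τ_j → τ_k → t`. If one side region is known to be empty, it is `p → τ_j →
t`. If `t` is in a positive cone, it is `p → τ_j → t` for both choices of `j`. `Good.algStep` shows
that every round lowers the bound by at least the length of the edge used, so that the path ends
within the initial budget (`Good.routesWithin`). The shorter of the two three-sided walks is at most
`C |st|` by the law of sines (`detour_expression`), and the positive walk is at most `|st| / sin
(θ₁/2)`, which is no worse than `C |st|` (`one_div_sin_le_routingConstant`).

Lower bound. Put `s` on the side opposite to `t = τ_i` and let a zigzag chain climb from `s` towards
`t` with points alternately near `τ_j` and `τ_k`. Its points are adjacent exactly when their indices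
differ by at most two, and only the last one sees `t`. Two chains that differ by one final point
look the same from `s`, but must be left at different corners. The common first move goes to one of
the corners, and for one of the chains it is the wrong one, which forces the walk `s → τ_j → τ_k →
t` or its mirror image. Letting the chain shrink to the corners gives the three-sided length, whose
maximal ratio to `|st|` is `C`. -/

theorem coord_smul_add (b : AffineBasis (Fin 3) ℝ Plane) (i : Fin 3) (r : ℝ) (v x : Plane) :
    b.coord i (r • v + x) = r * (b.coord i v - b.coord i 0) + b.coord i x := by
  have h1 := (b.coord i).map_vadd 0 (r • v + x)
  have h2 := (b.coord i).map_vadd 0 v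
  have h3 := (b.coord i).map_vadd 0 x
  simp only [vadd_eq_add, add_zero, map_add, map_smul, smul_eq_mul] at h1 h2 h3
  rw [h1, h2, h3]
  ring

theorem coord_add_eq_one (b : AffineBasis (Fin 3) ℝ Plane) {i j k : Fin 3} (hij : i ≠ j)
    (hik : i ≠ k) (hjk : j ≠ k) (v : Plane) :
    b.coord i v + b.coord j v + b.coord k v = 1 := by
  have h := b.sum_coord_apply_eq_one v
  rw [Fin.sum_univ_three] at h
  fin_cases i <;> fin_cases j <;> fin_cases k <;> simp at hij hik hjk ⊢ <;> linarith

theorem eq_or_eq_or_eq {i j k : Fin 3} (hij : i ≠ j) (hik : i ≠ k) (hjk : j ≠ k) (l : Fin 3) :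
    l = i ∨ l = j ∨ l = k := by
  omega

theorem forall_iff_of_distinct {i j k : Fin 3} (hij : i ≠ j) (hik : i ≠ k) (hjk : j ≠ k)
    {P : Fin 3 → Prop} : (∀ l, P l) ↔ P i ∧ P j ∧ P k := by
  constructor
  · exact fun h => ⟨h i, h j, h k⟩
  · rintro ⟨h1, h2, h3⟩ l
    rcases eq_or_eq_or_eq hij hik hjk l with rfl | rfl | rfl <;> assumption

theorem forall_ne_iff_of_distinct {i j k : Fin 3} (hij : i ≠ j) (hik : i ≠ k) (hjk : j ≠ k)
    {P : Fin 3 → Prop} : (∀ l, l ≠ i → P l) ↔ P j ∧ P k := by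
  constructor
  · exact fun h => ⟨h j hij.symm, h k hik.symm⟩
  · rintro ⟨h2, h3⟩ l hl
    rcases eq_or_eq_or_eq hij hik hjk l with rfl | rfl | rfl
    · exact absurd rfl hl
    · assumption
    · assumption

theorem sub_eq_smul_add_smul (b : AffineBasis (Fin 3) ℝ Plane) {i j k : Fin 3} (hij : i ≠ j)
    (hik : i ≠ k) (hjk : j ≠ k) (u v : Plane) :
    v - u = (b.coord i v - b.coord i u) • (b i - b k) +
      (b.coord j v - b.coord j u) • (b j - b k) := by
  have hs : ∀ w : Plane, w = b.coord i w • b i + b.coord j w • b j + b.coord k w • b k := by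
    intro w
    have h := b.linear_combination_coord_eq_self w
    rw [Fin.sum_univ_three] at h
    conv_lhs => rw [← h]
    clear h
    fin_cases i <;> fin_cases j <;> fin_cases k <;> simp at hij hik hjk ⊢ <;> abel
  have hu := coord_add_eq_one b hij hik hjk u
  have hv := coord_add_eq_one b hij hik hjk v
  have hu' : b.coord k u = 1 - b.coord i u - b.coord j u := by linarith
  have hv' : b.coord k v = 1 - b.coord i v - b.coord j v := by linarith
  have h1 := hs u
  have h2 := hs v
  rw [hu'] at h1
  rw [hv'] at h2
  generalize b.coord i u = ui at *
  generalize b.coord j u = uj at *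
  generalize b.coord i v = vi at *
  generalize b.coord j v = vj at *
  rw [h1, h2]
  module

/-! ### Side lengths -/

/-- The length of the side of the triangle opposite to the corner `i`. -/
noncomputable def sideLen (b : AffineBasis (Fin 3) ℝ Plane) (i : Fin 3) : ℝ :=
  dist (b (i + 1)) (b (i - 1))

theorem sideLen_eq (b : AffineBasis (Fin 3) ℝ Plane) {i j k : Fin 3} (hij : i ≠ j)
    (hik : i ≠ k) (hjk : j ≠ k) : sideLen b i = dist (b j) (b k) := by
  unfold sideLen
  fin_cases i <;> fin_cases j <;> fin_cases k <;> simp at hij hik hjk ⊢ <;>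
    first | rfl | exact dist_comm _ _

theorem sideLen_pos (b : AffineBasis (Fin 3) ℝ Plane) (i : Fin 3) : 0 < sideLen b i := by
  refine dist_pos.2 fun h => ?_
  have := b.ind.injective h
  revert this
  fin_cases i <;> decide

theorem sideLen_le_add (b : AffineBasis (Fin 3) ℝ Plane) {i j k : Fin 3} (hij : i ≠ j)
    (hik : i ≠ k) (hjk : j ≠ k) : sideLen b k ≤ sideLen b i + sideLen b j := by
  rw [sideLen_eq b hij hik hjk, sideLen_eq b hij.symm hjk hik,
    sideLen_eq b (i := k) (j := j) (k := i) hjk.symm hik.symm hij.symm, dist_comm (b i) (b k)]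
  exact dist_triangle _ _ _

/-- The right side is the length of a walk from `u` to `v` along directions of two sides. All
estimates of edge lengths come from it. -/
theorem dist_le_coord (b : AffineBasis (Fin 3) ℝ Plane) {i j k : Fin 3} (hij : i ≠ j)
    (hik : i ≠ k) (hjk : j ≠ k) (u v : Plane) :
    dist u v ≤ |b.coord i v - b.coord i u| * sideLen b j +
      |b.coord j v - b.coord j u| * sideLen b i := by
  rw [dist_comm, dist_eq_norm, sub_eq_smul_add_smul b hij hik hjk,
    sideLen_eq b hij hik hjk, sideLen_eq b hij.symm hjk hik, dist_eq_norm, dist_eq_norm]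
  refine (norm_add_le _ _).trans ?_
  rw [norm_smul, norm_smul, Real.norm_eq_abs, Real.norm_eq_abs]

theorem dist_eq_of_coord_eq (b : AffineBasis (Fin 3) ℝ Plane) {i j k : Fin 3} (hij : i ≠ j)
    (hik : i ≠ k) (hjk : j ≠ k) {u v : Plane} (h : b.coord i u = b.coord i v) :
    dist u v = |b.coord j v - b.coord j u| * sideLen b i := by
  rw [dist_comm, dist_eq_norm, sub_eq_smul_add_smul b hij hik hjk, h, sub_self, zero_smul,
    zero_add, norm_smul, Real.norm_eq_abs, sideLen_eq b hij hik hjk, dist_eq_norm]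

/-! ### Scaled translates of the triangle -/

/-- The triangle `r • △ + x` consists of the points whose coordinates are at least these. -/
noncomputable def low (b : AffineBasis (Fin 3) ℝ Plane) (r : ℝ) (x : Plane) (i : Fin 3) : ℝ :=
  b.coord i x - r * b.coord i 0

/-- The size of a triangle is determined by its lower bounds, so comparing sizes reduces to
comparing bounds. -/
theorem sum_low (b : AffineBasis (Fin 3) ℝ Plane) {i j k : Fin 3} (hij : i ≠ j)
    (hik : i ≠ k) (hjk : j ≠ k) (r : ℝ) (x : Plane) :
    low b r x i + low b r x j + low b r x k = 1 - r := by
  have h1 := coord_add_eq_one b hij hik hjk x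
  have h2 := coord_add_eq_one b hij hik hjk 0
  unfold low
  linear_combination h1 - r * h2

theorem coord_corner (b : AffineBasis (Fin 3) ℝ Plane) (r : ℝ) (x : Plane) (i j : Fin 3) :
    b.coord i (corner b r x j) = (if i = j then r else 0) + low b r x i := by
  unfold corner low
  rw [coord_smul_add, b.coord_apply]
  split_ifs <;> ring

theorem coord_triangle_pull (b : AffineBasis (Fin 3) ℝ Plane) {r : ℝ} (hr : 0 < r)
    (x z : Plane) (i : Fin 3) :
    b.coord i (r⁻¹ • (z + -x)) = r⁻¹ * (b.coord i z - low b r x i) := by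
  have h : z = r • (r⁻¹ • (z + -x)) + x := by
    rw [smul_smul, mul_inv_cancel₀ hr.ne', one_smul]
    abel
  have h2 := coord_smul_add b i r (r⁻¹ • (z + -x)) x
  rw [← h] at h2
  unfold low
  rw [h2]
  field_simp
  ring

/-- The homothety `v ↦ r • v + x` as a homeomorphism. -/
noncomputable def homothety (r : ℝ) (hr : r ≠ 0) (x : Plane) : Plane ≃ₜ Plane :=
  (Homeomorph.smulOfNeZero r hr).trans (Homeomorph.addRight x)

theorem triangle_eq_image (b : AffineBasis (Fin 3) ℝ Plane) {r : ℝ} (hr : 0 < r) (x : Plane) :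
    triangle b r x = homothety r hr.ne' x '' convexHull ℝ (Set.range b) := by
  have h : (homothety r hr.ne' x : Plane → Plane) =
      (r • AffineMap.id ℝ Plane + AffineMap.const ℝ Plane x : Plane →ᵃ[ℝ] Plane) := by
    ext1 v
    simp [homothety]
  rw [h, AffineMap.image_convexHull, ← Set.range_comp]
  unfold triangle
  congr 1

theorem mem_triangle_iff (b : AffineBasis (Fin 3) ℝ Plane) {r : ℝ} (hr : 0 < r) (x z : Plane) :
    z ∈ triangle b r x ↔ ∀ i, low b r x i ≤ b.coord i z := by
  rw [triangle_eq_image b hr, Homeomorph.image_eq_preimage_symm, b.convexHull_eq_nonneg_coord]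
  refine forall_congr' fun i => ?_
  change 0 ≤ b.coord i (r⁻¹ • (z + -x)) ↔ _
  rw [coord_triangle_pull b hr, mul_nonneg_iff_of_pos_left (inv_pos.2 hr), sub_nonneg]

theorem mem_interior_triangle_iff (b : AffineBasis (Fin 3) ℝ Plane) {r : ℝ} (hr : 0 < r)
    (x z : Plane) : z ∈ interior (triangle b r x) ↔ ∀ i, low b r x i < b.coord i z := by
  rw [triangle_eq_image b hr, ← Homeomorph.image_interior, Homeomorph.image_eq_preimage_symm,
    b.interior_convexHull]
  refine forall_congr' fun i => ?_
  change 0 < b.coord i (r⁻¹ • (z + -x)) ↔ _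
  rw [coord_triangle_pull b hr, mul_pos_iff_of_pos_left (inv_pos.2 hr), sub_pos]

theorem isClosed_triangle (b : AffineBasis (Fin 3) ℝ Plane) (r : ℝ) (x : Plane) :
    IsClosed (triangle b r x) :=
  ((Set.finite_range _).isCompact_convexHull ℝ).isClosed

theorem mem_frontier_triangle_iff (b : AffineBasis (Fin 3) ℝ Plane) {r : ℝ} (hr : 0 < r)
    (x z : Plane) : z ∈ frontier (triangle b r x) ↔
      (∀ i, low b r x i ≤ b.coord i z) ∧ ∃ i, b.coord i z = low b r x i := by
  rw [(isClosed_triangle b r x).frontier_eq, Set.mem_sdiff, mem_triangle_iff b hr,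
    mem_interior_triangle_iff b hr]
  refine and_congr_right fun h => ?_
  push Not
  exact exists_congr fun i => ⟨fun h' => le_antisymm h' (h i), fun h' => h'.le⟩

/-! ### The smallest triangle and the cones -/

/-- There is a scaled translate of the triangle with prescribed lower bounds. -/
theorem exists_low_eq (b : AffineBasis (Fin 3) ℝ Plane) (a : Fin 3 → ℝ) :
    ∃ x : Plane, ∀ i, low b (1 - (a 0 + a 1 + a 2)) x i = a i := by
  set r := 1 - (a 0 + a 1 + a 2) with hr
  -- `x₀` is the intended corner with index 2; it attains the bounds for the coordinates 0 and 1.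
  set x₀ : Plane := a 0 • b 0 + (a 1 • b 1 + (1 - a 0 - a 1) • b 2) with hx₀
  have hc : ∀ (i : Fin 3) (s t : ℝ), b.coord i (s • b 0 + (t • b 1 + (1 - s - t) • b 2)) =
      s * b.coord i (b 0) + t * b.coord i (b 1) + (1 - s - t) * b.coord i (b 2) := by
    intro i s t
    have h3 := coord_smul_add b i (1 - s - t) (b 2) 0
    rw [add_zero] at h3
    rw [coord_smul_add, coord_smul_add, h3]
    ring
  refine ⟨x₀ - r • b 2, fun i => ?_⟩
  have h := coord_smul_add b i r (b 2) (x₀ - r • b 2)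
  rw [add_sub_cancel, hx₀, hc, ← hx₀] at h
  unfold low
  simp only [b.coord_apply] at h
  fin_cases i <;> simp at h ⊢ <;> linarith

theorem exists_coord_lt (b : AffineBasis (Fin 3) ℝ Plane) {u v : Plane} (h : u ≠ v) :
    ∃ i, b.coord i u < b.coord i v := by
  by_contra! hc
  apply h
  refine b.ext_elem fun i => ?_
  have h1 := b.sum_coord_apply_eq_one u
  have h2 := b.sum_coord_apply_eq_one v
  rw [Fin.sum_univ_three] at h1 h2
  have h3 := hc 0
  have h4 := hc 1
  have h5 := hc 2
  fin_cases i <;> simp <;> linarith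

theorem exists_coord_le (b : AffineBasis (Fin 3) ℝ Plane) (u v : Plane) :
    ∃ i, b.coord i u ≤ b.coord i v := by
  rcases eq_or_ne u v with rfl | h
  · exact ⟨0, le_rfl⟩
  · exact (exists_coord_lt b h).imp fun _ => le_of_lt

theorem frontier_of_low_eq_min (b : AffineBasis (Fin 3) ℝ Plane) {u v : Plane} (h : u ≠ v)
    {r : ℝ} {x : Plane} (hl : ∀ i, low b r x i = min (b.coord i u) (b.coord i v)) :
    0 < r ∧ u ∈ frontier (triangle b r x) ∧ v ∈ frontier (triangle b r x) := by
  have hr : 0 < r := by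
    obtain ⟨i, hi⟩ := exists_coord_lt b h
    have h1 := sum_low b (i := 0) (j := 1) (k := 2) (by decide) (by decide) (by decide) r x
    have h2 := coord_add_eq_one b (i := 0) (j := 1) (k := 2) (by decide) (by decide)
      (by decide) v
    have hle : ∀ l, low b r x l ≤ b.coord l v := fun l => (hl l).trans_le (min_le_right _ _)
    have hlt : low b r x i < b.coord i v := (hl i).trans_lt ((min_le_left _ _).trans_lt hi)
    have h3 := hle 0
    have h4 := hle 1
    have h5 := hle 2
    fin_cases i <;> simp at hlt <;> linarith
  refine ⟨hr, (mem_frontier_triangle_iff b hr x u).2 ⟨fun i => ?_, ?_⟩,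
    (mem_frontier_triangle_iff b hr x v).2 ⟨fun i => ?_, ?_⟩⟩
  · exact (hl i).trans_le (min_le_left _ _)
  · obtain ⟨i, hi⟩ := exists_coord_le b u v
    exact ⟨i, by rw [hl i, min_eq_left hi]⟩
  · exact (hl i).trans_le (min_le_right _ _)
  · obtain ⟨i, hi⟩ := exists_coord_le b v u
    exact ⟨i, by rw [hl i, min_eq_right hi]⟩

theorem exists_low_eq_min (b : AffineBasis (Fin 3) ℝ Plane) (u v : Plane) :
    ∃ (r : ℝ) (x : Plane), ∀ i, low b r x i = min (b.coord i u) (b.coord i v) := by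
  obtain ⟨x, hx⟩ := exists_low_eq b fun i => min (b.coord i u) (b.coord i v)
  exact ⟨_, x, hx⟩

/-- Every triangle through both points has bounds at most these minima. As the bounds sum to `1 -
r`, minimality of `r` forces equality in all three. -/
theorem isSmallest_iff (b : AffineBasis (Fin 3) ℝ Plane) {u v : Plane} (h : u ≠ v)
    (r : ℝ) (x : Plane) : IsSmallest b u v r x ↔
      ∀ i, low b r x i = min (b.coord i u) (b.coord i v) := by
  have key : ∀ (r' : ℝ) (x' : Plane), 0 < r' → u ∈ frontier (triangle b r' x') →
      v ∈ frontier (triangle b r' x') → ∀ i, low b r' x' i ≤ min (b.coord i u) (b.coord i v) := by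
    intro r' x' hr' hu hv i
    exact le_min (((mem_frontier_triangle_iff b hr' x' u).1 hu).1 i)
      (((mem_frontier_triangle_iff b hr' x' v).1 hv).1 i)
  have hsum := fun r x => sum_low b (i := 0) (j := 1) (k := 2) (by decide) (by decide)
    (by decide) r x
  constructor
  · rintro ⟨⟨hr, hu, hv⟩, hmin⟩
    obtain ⟨r₀, x₀, h₀⟩ := exists_low_eq_min b u v
    obtain ⟨hr₀, hu₀, hv₀⟩ := frontier_of_low_eq_min b h h₀
    have h1 := hmin r₀ x₀ hr₀ hu₀ hv₀
    have h2 := key r x hr hu hv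
    have h3 := hsum r x
    have h4 := hsum r₀ x₀
    rw [h₀, h₀, h₀] at h4
    intro i
    have e0 := h2 0
    have e1 := h2 1
    have e2 := h2 2
    refine le_antisymm (h2 i) ?_
    fin_cases i <;> simp only [Fin.zero_eta, Fin.mk_one, Fin.reduceFinMk] <;> linarith
  · intro hl
    refine ⟨frontier_of_low_eq_min b h hl, fun r' x' hr' hu hv => ?_⟩
    have h2 := key r' x' hr' hu hv
    have h3 := hsum r x
    have h4 := hsum r' x'
    rw [hl, hl, hl] at h3
    have e0 := h2 0
    have e1 := h2 1
    have e2 := h2 2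
    linarith

/-- A single point lies on arbitrarily small triangles. This is why cones do not contain their apex.
-/
theorem not_isSmallest_self (b : AffineBasis (Fin 3) ℝ Plane) (u : Plane) (r : ℝ) (x : Plane) :
    ¬ IsSmallest b u u r x := by
  rintro ⟨⟨hr, -, -⟩, hmin⟩
  have hc : u ∈ frontier (triangle b (r / 2) (u - (r / 2) • b 0)) := by
    rw [mem_frontier_triangle_iff b (half_pos hr)]
    have hu : u = corner b (r / 2) (u - (r / 2) • b 0) 0 := by
      unfold corner
      abel
    have hco : ∀ i, b.coord i u = (if i = 0 then r / 2 else 0) +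
        low b (r / 2) (u - (r / 2) • b 0) i := by
      intro i
      conv_lhs => rw [hu]
      exact coord_corner _ _ _ _ _
    refine ⟨fun i => ?_, 1, ?_⟩
    · rw [hco]
      split_ifs <;> linarith
    · rw [hco]
      simp
  have := hmin _ _ (half_pos hr) hc hc
  linarith

theorem eq_corner_iff (b : AffineBasis (Fin 3) ℝ Plane) (r : ℝ) (x p : Plane) (i : Fin 3) :
    p = corner b r x i ↔ ∀ l, l ≠ i → b.coord l p = low b r x l := by
  constructor
  · rintro rfl l hl
    rw [coord_corner, if_neg hl, zero_add]
  · intro h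
    have hne : ∀ l, l ≠ i → b.coord l p = b.coord l (corner b r x i) := by
      intro l hl
      rw [h l hl, coord_corner, if_neg hl, zero_add]
    refine b.ext_elem fun l => ?_
    by_cases hl : l = i
    · subst hl
      have e1 : l ≠ l + 1 := by omega
      have e2 : l ≠ l - 1 := by omega
      have e3 : l + 1 ≠ l - 1 := by omega
      have h1 := coord_add_eq_one b e1 e2 e3 p
      have h2 := coord_add_eq_one b e1 e2 e3 (corner b r x l)
      rw [hne _ e1.symm, hne _ e2.symm] at h1
      linarith
    · exact hne l hl

theorem eq_corner_left_iff (b : AffineBasis (Fin 3) ℝ Plane) {p v : Plane} {r : ℝ} {x : Plane}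
    (hl : ∀ i, low b r x i = min (b.coord i p) (b.coord i v)) (i : Fin 3) :
    p = corner b r x i ↔ ∀ l, l ≠ i → b.coord l p ≤ b.coord l v := by
  rw [eq_corner_iff]
  refine forall₂_congr fun l _ => ?_
  rw [hl, eq_comm, min_eq_left_iff]

theorem eq_corner_right_iff (b : AffineBasis (Fin 3) ℝ Plane) {p v : Plane} {r : ℝ} {x : Plane}
    (hl : ∀ i, low b r x i = min (b.coord i p) (b.coord i v)) (i : Fin 3) :
    v = corner b r x i ↔ ∀ l, l ≠ i → b.coord l v ≤ b.coord l p := by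
  rw [eq_corner_iff]
  refine forall₂_congr fun l _ => ?_
  rw [hl, eq_comm, min_eq_right_iff]

theorem mem_posCone_iff (b : AffineBasis (Fin 3) ℝ Plane) (p v : Plane) (i : Fin 3) :
    v ∈ posCone b p i ↔ p ≠ v ∧ ∀ l, l ≠ i → b.coord l p ≤ b.coord l v := by
  constructor
  · rintro ⟨r, x, hs, hp⟩
    have hne : p ≠ v := by
      rintro rfl
      exact not_isSmallest_self b _ _ _ hs
    exact ⟨hne, (eq_corner_left_iff b ((isSmallest_iff b hne r x).1 hs) i).1 hp⟩
  · rintro ⟨hne, h⟩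
    obtain ⟨r, x, hl⟩ := exists_low_eq_min b p v
    exact ⟨r, x, (isSmallest_iff b hne r x).2 hl, (eq_corner_left_iff b hl i).2 h⟩

theorem mem_negCone_iff (b : AffineBasis (Fin 3) ℝ Plane) (p v : Plane) (i : Fin 3) :
    v ∈ negCone b p i ↔ p ≠ v ∧ ∀ l, l ≠ i → b.coord l v ≤ b.coord l p := by
  constructor
  · rintro ⟨r, x, hs, hp⟩
    have hne : p ≠ v := by
      rintro rfl
      exact not_isSmallest_self b _ _ _ hs
    exact ⟨hne, (eq_corner_right_iff b ((isSmallest_iff b hne r x).1 hs) i).1 hp⟩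
  · rintro ⟨hne, h⟩
    obtain ⟨r, x, hl⟩ := exists_low_eq_min b p v
    exact ⟨r, x, (isSmallest_iff b hne r x).2 hl, (eq_corner_right_iff b hl i).2 h⟩

/-- Of the three signs of the coordinate differences two agree, and the remaining index names the
cone. -/
theorem exists_mem_cone (b : AffineBasis (Fin 3) ℝ Plane) {p v : Plane} (h : p ≠ v) :
    (∃ i, v ∈ negCone b p i) ∨ ∃ i, v ∈ posCone b p i := by
  simp only [mem_negCone_iff, mem_posCone_iff, h, ne_eq, not_false_eq_true, true_and,
    Fin.exists_fin_succ, Fin.forall_fin_succ]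
  rcases le_total (b.coord 0 p) (b.coord 0 v) with h0 | h0 <;>
    rcases le_total (b.coord 1 p) (b.coord 1 v) with h1 | h1 <;>
    rcases le_total (b.coord 2 p) (b.coord 2 v) with h2 | h2 <;> simp [h0, h1, h2]

/-! ### Adjacency, general position, neighbourhoods -/

/-- Any triangle through `u` and `v` has lower bounds at most the coordinatewise minima, so its
interior contains that of `T^{u,v}`, and only `T^{u,v}` has to be tested. -/
theorem tdGraph_adj_iff (b : AffineBasis (Fin 3) ℝ Plane) (S : Set Plane) (u v : Plane) :
    (tdGraph b S).Adj u v ↔ u ≠ v ∧ u ∈ S ∧ v ∈ S ∧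
      ∀ w ∈ S, ∃ i, b.coord i w ≤ min (b.coord i u) (b.coord i v) := by
  refine and_congr_right fun hne => and_congr_right fun _ => and_congr_right fun _ => ?_
  constructor
  · rintro ⟨r, x, hr, hu, hv, h⟩ w hw
    have := h w hw
    rw [mem_interior_triangle_iff b hr] at this
    push Not at this
    obtain ⟨i, hi⟩ := this
    exact ⟨i, hi.trans (le_min (((mem_frontier_triangle_iff b hr x u).1 hu).1 i)
      (((mem_frontier_triangle_iff b hr x v).1 hv).1 i))⟩
  · intro h
    obtain ⟨r, x, hl⟩ := exists_low_eq_min b u v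
    obtain ⟨hr, hu, hv⟩ := frontier_of_low_eq_min b hne hl
    refine ⟨r, x, hr, hu, hv, fun w hw => ?_⟩
    rw [mem_interior_triangle_iff b hr]
    push Not
    obtain ⟨i, hi⟩ := h w hw
    exact ⟨i, by rwa [hl]⟩

/-- Lines parallel to a side are the level lines of the coordinate of the opposite corner. -/
theorem generalPosition_iff (b : AffineBasis (Fin 3) ℝ Plane) (S : Set Plane) :
    GeneralPosition b S ↔ ∀ u ∈ S, ∀ v ∈ S, u ≠ v → ∀ i, b.coord i u ≠ b.coord i v := by
  constructor
  · intro h u hu v hv hne i hi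
    have e1 : i ≠ i + 1 := by omega
    have e2 : i ≠ i - 1 := by omega
    have e3 : i + 1 ≠ i - 1 := by omega
    refine h u hu v hv hne (i - 1) (i + 1) e3.symm (b.coord (i + 1) v - b.coord (i + 1) u) ?_
    rw [sub_eq_smul_add_smul b e1 e2 e3, hi, sub_self, zero_smul, zero_add]
  · intro h u hu v hv hne i j hij c hc
    obtain ⟨k, hki, hkj⟩ : ∃ k : Fin 3, k ≠ i ∧ k ≠ j := by
      revert hij
      fin_cases i <;> fin_cases j <;> decide
    apply h u hu v hv hne k
    have h1 : v = c • b j + (-c • b i + u) := by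
      rw [eq_add_of_sub_eq hc]
      module
    have h2 := coord_smul_add b k c (b j) (-c • b i + u)
    rw [← h1, coord_smul_add, b.coord_apply_ne hki, b.coord_apply_ne hkj] at h2
    linarith

theorem mem_nbhd_one_iff (G : SimpleGraph Plane) (u v : Plane) :
    v ∈ nbhd G 1 u ↔ v = u ∨ G.Adj u v := by
  constructor
  · rintro ⟨w, hw⟩
    cases w with
    | nil => exact Or.inl rfl
    | cons h q =>
      rw [SimpleGraph.Walk.length_cons] at hw
      have := SimpleGraph.Walk.eq_of_length_eq_zero (p := q) (by omega)
      exact Or.inr (this ▸ h)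
  · rintro (rfl | h)
    · exact ⟨SimpleGraph.Walk.nil, by simp⟩
    · exact ⟨h.toWalk, by simp⟩

theorem mem_nbhd_one_diff_iff (G : SimpleGraph Plane) (u v : Plane) :
    v ∈ nbhd G 1 u \ {u} ↔ G.Adj u v := by
  rw [Set.mem_sdiff, mem_nbhd_one_iff, Set.mem_singleton_iff]
  constructor
  · rintro ⟨h | h, h'⟩
    · exact absurd h h'
    · exact h
  · exact fun h => ⟨Or.inr h, h.ne'⟩

/-! ### A potential for the explicit algorithm -/

theorem GeneralPosition.eq_of_coord_eq {b : AffineBasis (Fin 3) ℝ Plane} {S : Set Plane}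
    (hG : GeneralPosition b S) {u v : Plane} (hu : u ∈ S) (hv : v ∈ S) {i : Fin 3}
    (h : b.coord i u = b.coord i v) : u = v := by
  by_contra hne
  exact (generalPosition_iff b S).1 hG u hu v hv hne i h

theorem dist_le_of_coord_le (b : AffineBasis (Fin 3) ℝ Plane) {i j k : Fin 3} (hij : i ≠ j)
    (hik : i ≠ k) (hjk : j ≠ k) {u v : Plane} (h₁ : b.coord i v ≤ b.coord i u)
    (h₂ : b.coord j u ≤ b.coord j v) :
    dist u v ≤ (b.coord i u - b.coord i v) * sideLen b j +
      (b.coord j v - b.coord j u) * sideLen b i := by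
  have h := dist_le_coord b hij hik hjk u v
  rwa [abs_of_nonneg (sub_nonneg.2 h₂), abs_of_nonpos (sub_nonpos.2 h₁), neg_sub] at h

/-- For `t` in the negative cone of `p` with index `i`: no point of `S` lies in the part of
`T^{p,t}` that belongs to the positive cone of `p` with index `j`. -/
def EmptySide (b : AffineBasis (Fin 3) ℝ Plane) (S : Set Plane) (p t : Plane)
    (i j k : Fin 3) : Prop :=
  ∀ z ∈ S, b.coord i p < b.coord i z → b.coord k p < b.coord k z → b.coord j z ≤ b.coord j t

/-- The point `z` lies in the part of `T^{p,t}` that belongs to the negative cone of `p`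
which contains `t`; the two other indices are `j` and `k`. -/
structure Mid (b : AffineBasis (Fin 3) ℝ Plane) (p t : Plane) (j k : Fin 3)
    (z : Plane) : Prop where
  lt_left : b.coord j z < b.coord j p
  lt_right : b.coord k z < b.coord k p
  le_left : b.coord j t ≤ b.coord j z
  le_right : b.coord k t ≤ b.coord k z

theorem Mid.symm {b : AffineBasis (Fin 3) ℝ Plane} {p t z : Plane} {j k : Fin 3}
    (h : Mid b p t j k z) : Mid b p t k j z :=
  ⟨h.lt_right, h.lt_left, h.le_right, h.le_left⟩

/-- The number `c` bounds the length of the path from `p` to `t` found by the algorithm. -/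
inductive Good (b : AffineBasis (Fin 3) ℝ Plane) (S : Set Plane) (t p : Plane) (c : ℝ) : Prop
  | arrived (h : p = t) (hc : 0 ≤ c) : Good b S t p c
  -- Here `p` is the corner `i` of `T^{p,t}`. The two costs are the lengths of the walks to `t`
  -- through the corners `j` and `k`; both are needed, since it is open on which side of `t` the
  -- path will pass.
  | pos (i j k : Fin 3) (hij : i ≠ j) (hik : i ≠ k) (hjk : j ≠ k)
      (hj : b.coord j p < b.coord j t) (hk : b.coord k p < b.coord k t)
      (hc : (b.coord i p - b.coord i t) * sideLen b k +
        (b.coord k t - b.coord k p) * sideLen b i ≤ c)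
      (hc' : (b.coord i p - b.coord i t) * sideLen b j +
        (b.coord j t - b.coord j p) * sideLen b i ≤ c) : Good b S t p c
  -- Here `t` is the corner `i`. The empty region is the one at the corner `k`, and the cost is that
  -- of the walk `p → τ_j → t`.
  | side (i j k : Fin 3) (hij : i ≠ j) (hik : i ≠ k) (hjk : j ≠ k)
      (hj : b.coord j t < b.coord j p) (hk : b.coord k t < b.coord k p)
      (hE : EmptySide b S p t i j k)
      (hc : (b.coord k p - b.coord k t) * sideLen b i +
        (b.coord i t - b.coord i p) * sideLen b k ≤ c) : Good b S t p c
  -- The cost of `p → τ_j → τ_k → t`, with no information about the regions.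
  | any (i j k : Fin 3) (hij : i ≠ j) (hik : i ≠ k) (hjk : j ≠ k)
      (hj : b.coord j t < b.coord j p) (hk : b.coord k t < b.coord k p)
      (hc : (b.coord i t - b.coord i p) * (sideLen b i + sideLen b j) +
        (b.coord k p - b.coord k t) * sideLen b i ≤ c) : Good b S t p c

/-- Together with a positive minimal edge length this gives termination. -/
theorem Good.nonneg {b : AffineBasis (Fin 3) ℝ Plane} {S : Set Plane} {t p : Plane} {c : ℝ}
    (h : Good b S t p c) : 0 ≤ c := by
  cases h with
  | arrived h hc => exact hc
  | pos i j k hij hik hjk hj hk hc hc' =>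
    have sp := coord_add_eq_one b hij hik hjk p
    have st := coord_add_eq_one b hij hik hjk t
    have h1 := mul_nonneg (show 0 ≤ b.coord i p - b.coord i t by linarith) (sideLen_pos b k).le
    have h2 := mul_nonneg (show 0 ≤ b.coord k t - b.coord k p by linarith) (sideLen_pos b i).le
    linarith
  | side i j k hij hik hjk hj hk hE hc =>
    have sp := coord_add_eq_one b hij hik hjk p
    have st := coord_add_eq_one b hij hik hjk t
    have h1 := mul_nonneg (show 0 ≤ b.coord i t - b.coord i p by linarith) (sideLen_pos b k).le
    have h2 := mul_nonneg (show 0 ≤ b.coord k p - b.coord k t by linarith) (sideLen_pos b i).le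
    linarith
  | any i j k hij hik hjk hj hk hc =>
    have sp := coord_add_eq_one b hij hik hjk p
    have st := coord_add_eq_one b hij hik hjk t
    have h1 := mul_nonneg (show 0 ≤ b.coord i t - b.coord i p by linarith)
      (add_pos (sideLen_pos b i) (sideLen_pos b j)).le
    have h2 := mul_nonneg (show 0 ≤ b.coord k p - b.coord k t by linarith) (sideLen_pos b i).le
    linarith

/-! ### How the bound drops along one edge -/

section Steps

variable {b : AffineBasis (Fin 3) ℝ Plane} {S : Set Plane} {p t q : Plane} {i j k : Fin 3}
  {c : ℝ}

/-- A neighbour in the middle region that is closest to an empty side region. -/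
theorem exists_adj_mid (hS : S.Finite) (hG : GeneralPosition b S) (hij : i ≠ j) (hik : i ≠ k)
    (hjk : j ≠ k) (hp : p ∈ S) (hE : EmptySide b S p t i j k) {z : Plane} (hz : z ∈ S)
    (hm : Mid b p t j k z)
    (hk : ∀ y ∈ S, b.coord i p < b.coord i y → b.coord j p < b.coord j y →
      b.coord k y ≤ b.coord k z) :
    ∃ w, (tdGraph b S).Adj p w ∧ Mid b p t j k w ∧
      ∀ y ∈ S, Mid b p t j k y → b.coord k y ≤ b.coord k w := by
  obtain ⟨w, ⟨hw, hwm⟩, hmax⟩ := Set.exists_max_image {y | y ∈ S ∧ Mid b p t j k y}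
    (fun y => b.coord k y) (hS.subset fun y hy => hy.1) ⟨z, hz, hm⟩
  refine ⟨w, ?_, hwm, fun y hy hym => hmax y ⟨hy, hym⟩⟩
  rw [tdGraph_adj_iff]
  refine ⟨?_, hp, hw, fun y hy => ?_⟩
  · rintro rfl
    exact lt_irrefl _ hwm.lt_left
  by_contra! hc
  have sp := coord_add_eq_one b hij hik hjk p
  have sw := coord_add_eq_one b hij hik hjk w
  have sy := coord_add_eq_one b hij hik hjk y
  have h1 := hwm
  have h2 := hc i
  have h3 := hc j
  have h4 := hc k
  rw [min_eq_left (by linarith [h1.lt_left, h1.lt_right])] at h2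
  rw [min_eq_right h1.lt_left.le] at h3
  rw [min_eq_right h1.lt_right.le] at h4
  have hne : y ≠ p := fun h => lt_irrefl _ (h ▸ h2)
  -- A point `y` inside `T^{p,w}` would lie in the middle region, against maximality of `w`, in the
  -- side region bounded by `hk`, or in the empty one.
  rcases lt_trichotomy (b.coord k y) (b.coord k p) with hky | hky | hky
  · rcases lt_trichotomy (b.coord j y) (b.coord j p) with hjy | hjy | hjy
    · have := hmax y ⟨hy, hjy, hky, h1.le_left.trans h3.le, h1.le_right.trans h4.le⟩
      linarith
    · exact hne (hG.eq_of_coord_eq hy hp hjy)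
    · have h5 := hk y hy h2 hjy
      have h6 := hmax z ⟨hz, hm⟩
      linarith
  · exact hne (hG.eq_of_coord_eq hy hp hky)
  · have := hE y hy h2 hky
    linarith [h1.le_left]

/-- The edge in a positive cone leads to the first point met when `T` grows from its corner at `p`:
a point of the cone beyond this would be inside the triangle of the edge. -/
theorem coord_le_of_adj_posCone (hik : i ≠ k) (hjk : j ≠ k)
    (hij : i ≠ j) (hq : (tdGraph b S).Adj p q) (hi : b.coord i p ≤ b.coord i q)
    (hj : b.coord j p ≤ b.coord j q) {y : Plane} (hy : y ∈ S) (hiy : b.coord i p < b.coord i y)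
    (hjy : b.coord j p < b.coord j y) : b.coord k y ≤ b.coord k q := by
  obtain ⟨l, hl⟩ := ((tdGraph_adj_iff b S p q).1 hq).2.2.2 y hy
  rcases eq_or_eq_or_eq hij hik hjk l with rfl | rfl | rfl
  · rw [min_eq_left hi] at hl
    linarith
  · rw [min_eq_left hj] at hl
    linarith
  · exact hl.trans (min_le_right _ _)

/-- After the edge, `t` is still in the same positive cone, or `q` has passed `t` on one side. In
the second case `t` is in a negative cone of `q`, and the part of the old cone before `q` is free of
points, which is exactly an empty side region; the walk past that side of `t` is the one that
remains. -/
theorem Good.pos_step (hG : GeneralPosition b S) (ht : t ∈ S) (hij : i ≠ j) (hik : i ≠ k)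
    (hjk : j ≠ k) (hj : b.coord j p < b.coord j t) (hk : b.coord k p < b.coord k t)
    (hc : (b.coord i p - b.coord i t) * sideLen b k +
      (b.coord k t - b.coord k p) * sideLen b i ≤ c)
    (hc' : (b.coord i p - b.coord i t) * sideLen b j +
      (b.coord j t - b.coord j p) * sideLen b i ≤ c)
    (hq : (tdGraph b S).Adj p q) (hjq : b.coord j p < b.coord j q)
    (hkq : b.coord k p < b.coord k q) : Good b S t q (c - dist p q) := by
  have hqS := hq.2.2.1
  have sp := coord_add_eq_one b hij hik hjk p
  have st := coord_add_eq_one b hij hik hjk t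
  have sq := coord_add_eq_one b hij hik hjk q
  have hit : b.coord i t ≤ b.coord i q :=
    coord_le_of_adj_posCone hij.symm hik.symm hjk hq hjq.le hkq.le ht hj hk
  have d1 := dist_le_of_coord_le b hij hik hjk (u := p) (v := q) (by linarith) hjq.le
  have d2 := dist_le_of_coord_le b hik hij hjk.symm (u := p) (v := q) (by linarith) hkq.le
  by_cases hqt : q = t
  · subst hqt
    exact Good.arrived rfl (by linarith)
  have hjt : b.coord j q ≠ b.coord j t := fun h => hqt (hG.eq_of_coord_eq hqS ht h)
  have hkt : b.coord k q ≠ b.coord k t := fun h => hqt (hG.eq_of_coord_eq hqS ht h)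
  have hit' : b.coord i t < b.coord i q :=
    lt_of_le_of_ne hit fun h => hqt (hG.eq_of_coord_eq ht hqS h).symm
  rcases lt_or_gt_of_ne hjt with h1 | h1 <;> rcases lt_or_gt_of_ne hkt with h2 | h2
  · exact Good.pos i j k hij hik hjk h1 h2 (by linarith) (by linarith)
  · refine Good.side j k i hjk hij.symm hik.symm h2 hit' (fun z hz hz1 hz2 => ?_) (by linarith)
    by_contra! hz3
    have := coord_le_of_adj_posCone hij.symm hik.symm hjk hq hjq.le hkq.le hz (by linarith)
      (by linarith)
    linarith
  · refine Good.side k j i hjk.symm hik.symm hij.symm h1 hit' (fun z hz hz1 hz2 => ?_)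
      (by linarith)
    by_contra! hz3
    have := coord_le_of_adj_posCone hij.symm hik.symm hjk hq hjq.le hkq.le hz (by linarith)
      (by linarith)
    linarith
  · linarith

/-- A point in the new side region of `q` would have been in the old empty region or in the old
middle region with a larger coordinate `k`. So emptiness is inherited, and the edge costs at most
what the walk `p → τ_j → t` loses. -/
theorem Good.side_mid_step (hG : GeneralPosition b S) (hp : p ∈ S) (ht : t ∈ S) (hij : i ≠ j)
    (hik : i ≠ k) (hjk : j ≠ k) (hE : EmptySide b S p t i j k)
    (hc : (b.coord k p - b.coord k t) * sideLen b i +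
        (b.coord i t - b.coord i p) * sideLen b k ≤ c)
    (hq : (tdGraph b S).Adj p q) (hm : Mid b p t j k q)
    (hmax : ∀ y ∈ S, Mid b p t j k y → b.coord k y ≤ b.coord k q) :
    Good b S t q (c - dist p q) := by
  have hqS := hq.2.2.1
  have sp := coord_add_eq_one b hij hik hjk p
  have st := coord_add_eq_one b hij hik hjk t
  have sq := coord_add_eq_one b hij hik hjk q
  have d := dist_le_of_coord_le b hik.symm hjk.symm hij (u := p) (v := q) hm.lt_right.le
    (by linarith [hm.lt_left, hm.lt_right])
  by_cases hqt : q = t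
  · subst hqt
    exact Good.arrived rfl (by linarith)
  have hjt := lt_of_le_of_ne hm.le_left fun h => hqt (hG.eq_of_coord_eq ht hqS h).symm
  have hkt := lt_of_le_of_ne hm.le_right fun h => hqt (hG.eq_of_coord_eq ht hqS h).symm
  refine Good.side i j k hij hik hjk hjt hkt (fun z hz hz1 hz2 => ?_) (by linarith)
  by_contra! hz3
  have sz := coord_add_eq_one b hij hik hjk z
  have hzi : b.coord i p < b.coord i z := by linarith [hm.lt_left, hm.lt_right]
  rcases lt_trichotomy (b.coord k z) (b.coord k p) with hkz | hkz | hkz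
  · have := hmax z hz ⟨by linarith [hm.lt_left], hkz, hz3.le, by linarith⟩
    linarith
  · have := hG.eq_of_coord_eq hz hp hkz
    subst this
    linarith
  · linarith [hE z hz hzi hkz]

/-- Moving into the other side region also keeps the region empty. A point of the new region would
be in the old empty region, or beyond the edge in its positive cone, or in the middle region; the
last would produce a neighbour there by `exists_adj_mid`. -/
theorem Good.side_side_step (hS : S.Finite) (hG : GeneralPosition b S) (hp : p ∈ S)
    (ht : t ∈ S) (hij : i ≠ j)
    (hik : i ≠ k) (hjk : j ≠ k) (hj : b.coord j t < b.coord j p)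
    (hE : EmptySide b S p t i j k)
    (hc : (b.coord k p - b.coord k t) * sideLen b i +
        (b.coord i t - b.coord i p) * sideLen b k ≤ c)
    (hM : ∀ w, (tdGraph b S).Adj p w → ¬ Mid b p t j k w)
    (hq : (tdGraph b S).Adj p q) (hiq : b.coord i p < b.coord i q)
    (hjq : b.coord j p < b.coord j q) (hkq : b.coord k t ≤ b.coord k q) :
    Good b S t q (c - dist p q) := by
  have hqS := hq.2.2.1
  have sp := coord_add_eq_one b hij hik hjk p
  have st := coord_add_eq_one b hij hik hjk t
  have sq := coord_add_eq_one b hij hik hjk q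
  have d := dist_le_of_coord_le b hik.symm hjk.symm hij (u := p) (v := q) (by linarith) hiq.le
  have hqt : q ≠ t := by
    rintro rfl
    linarith
  have hkt := lt_of_le_of_ne hkq fun h => hqt (hG.eq_of_coord_eq ht hqS h).symm
  refine Good.side i j k hij hik hjk (by linarith) hkt (fun z hz hz1 hz2 => ?_) (by linarith)
  by_contra! hz3
  have sz := coord_add_eq_one b hij hik hjk z
  have hzi : b.coord i p < b.coord i z := by linarith
  have hzp : z ≠ p := fun h => lt_irrefl _ (h ▸ hzi)
  have hzj : b.coord j z < b.coord j p := by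
    by_contra! h
    have h' := lt_of_le_of_ne h fun h => hzp (hG.eq_of_coord_eq hp hz h).symm
    have := coord_le_of_adj_posCone hik hjk hij hq hiq.le hjq.le hz hzi h'
    linarith
  rcases lt_trichotomy (b.coord k z) (b.coord k p) with hkz | hkz | hkz
  · obtain ⟨w, hw, hwm, -⟩ := exists_adj_mid hS hG hij hik hjk hp hE hz
      ⟨hzj, hkz, hz3.le, by linarith⟩ fun y hy hy1 hy2 =>
        (coord_le_of_adj_posCone hik hjk hij hq hiq.le hjq.le hy hy1 hy2).trans hz2.le
    exact hM w hw hwm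
  · exact hzp (hG.eq_of_coord_eq hz hp hkz)
  · linarith [hE z hz hzi hkz]

/-- The gain in height `i` is paid with `sideLen b i + sideLen b j`, which exceeds the rate `sideLen
b k` of the edge by the triangle inequality. -/
theorem Good.any_mid_step (hG : GeneralPosition b S) (ht : t ∈ S) (hij : i ≠ j)
    (hik : i ≠ k) (hjk : j ≠ k)
    (hc : (b.coord i t - b.coord i p) * (sideLen b i + sideLen b j) +
        (b.coord k p - b.coord k t) * sideLen b i ≤ c)
    (hq : (tdGraph b S).Adj p q) (hm : Mid b p t j k q) : Good b S t q (c - dist p q) := by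
  have hqS := hq.2.2.1
  have sp := coord_add_eq_one b hij hik hjk p
  have st := coord_add_eq_one b hij hik hjk t
  have sq := coord_add_eq_one b hij hik hjk q
  have hi : b.coord i p ≤ b.coord i q := by linarith [hm.lt_left, hm.lt_right]
  have d := dist_le_of_coord_le b hik.symm hjk.symm hij (u := p) (v := q) hm.lt_right.le hi
  have d' := mul_le_mul_of_nonneg_left (sideLen_le_add b hij hik hjk) (sub_nonneg.2 hi)
  by_cases hqt : q = t
  · subst hqt
    exact Good.arrived rfl (by linarith)
  have hjt := lt_of_le_of_ne hm.le_left fun h => hqt (hG.eq_of_coord_eq ht hqS h).symm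
  have hkt := lt_of_le_of_ne hm.le_right fun h => hqt (hG.eq_of_coord_eq ht hqS h).symm
  exact Good.any i j k hij hik hjk hjt hkt (by linarith)

/-- The edge goes into the region at the corner `j`, the first corner of the walk, so the coordinate
`k` decreases and the walk pays for it. -/
theorem Good.any_side_step (hG : GeneralPosition b S) (ht : t ∈ S) (hij : i ≠ j)
    (hik : i ≠ k) (hjk : j ≠ k) (hj : b.coord j t < b.coord j p)
    (hc : (b.coord i t - b.coord i p) * (sideLen b i + sideLen b j) +
        (b.coord k p - b.coord k t) * sideLen b i ≤ c)
    (hq : (tdGraph b S).Adj p q) (hiq : b.coord i p < b.coord i q)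
    (hjq : b.coord j p < b.coord j q) (hkq : b.coord k t ≤ b.coord k q) :
    Good b S t q (c - dist p q) := by
  have hqS := hq.2.2.1
  have sp := coord_add_eq_one b hij hik hjk p
  have st := coord_add_eq_one b hij hik hjk t
  have sq := coord_add_eq_one b hij hik hjk q
  have d := dist_le_of_coord_le b hik.symm hjk.symm hij (u := p) (v := q) (by linarith) hiq.le
  have d' := mul_le_mul_of_nonneg_left (sideLen_le_add b hij hik hjk) (sub_nonneg.2 hiq.le)
  have hqt : q ≠ t := by
    rintro rfl
    linarith
  have hkt := lt_of_le_of_ne hkq fun h => hqt (hG.eq_of_coord_eq ht hqS h).symm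
  exact Good.any i j k hij hik hjk (by linarith) hkt (by linarith)

end Steps

/-! ### Angles in the cones -/

open RealInnerProductSpace in
-- Otherwise the part of `f` orthogonal to `e` vanishes, while its coordinate `k` is a non-zero
-- multiple of that of `f`.
theorem gram_pos (b : AffineBasis (Fin 3) ℝ Plane) {i j k : Fin 3} (hij : i ≠ j)
    (hik : i ≠ k) (hjk : j ≠ k) :
    0 < ⟪b j - b i, b j - b i⟫ * ⟪b k - b i, b k - b i⟫ -
      ⟪b j - b i, b k - b i⟫ * ⟪b j - b i, b k - b i⟫ := by
  set e := b j - b i with he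
  set f := b k - b i with hf
  have hne : e ≠ 0 := sub_ne_zero.2 (b.ind.injective.ne hij.symm)
  have hA : 0 < ⟪e, e⟫ := real_inner_self_pos.2 hne
  by_contra! hc
  have h0 : ⟪e, e⟫ • f - ⟪e, f⟫ • e = 0 := by
    rw [← real_inner_self_nonpos]
    simp only [inner_sub_left, inner_sub_right, real_inner_smul_left, real_inner_smul_right,
      real_inner_comm e f]
    nlinarith
  have h1 := congrArg (b.coord k).linear h0
  have h2 : (b.coord k).linear e = 0 := by
    have := (b.coord k).linearMap_vsub (b j) (b i)
    rwa [b.coord_apply_ne hjk.symm, b.coord_apply_ne hik.symm, vsub_self] at this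
  have h3 : (b.coord k).linear f = 1 := by
    have := (b.coord k).linearMap_vsub (b k) (b i)
    rwa [b.coord_apply_eq, b.coord_apply_ne hik.symm, vsub_eq_sub, vsub_eq_sub, sub_zero] at this
  rw [map_sub, map_smul, map_smul, h2, h3, map_zero] at h1
  simp only [smul_eq_mul, mul_one, mul_zero, sub_zero] at h1
  exact hA.ne' h1

open RealInnerProductSpace in
-- The sine of the difference of the two angles is a positive multiple of `γ' * β - γ * β'`, and the
-- difference is at most `π` in absolute value.
theorem angle_add_smul_lt {V : Type*} [NormedAddCommGroup V] [InnerProductSpace ℝ V] {e f : V}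
    (hG : 0 < ⟪e, e⟫ * ⟪f, f⟫ - ⟪e, f⟫ * ⟪e, f⟫) {β γ β' γ' : ℝ} (hγ : 0 ≤ γ)
    (hγ' : 0 ≤ γ') (h : γ' * β < γ * β') :
    InnerProductGeometry.angle (β' • e + γ' • f) e <
      InnerProductGeometry.angle (β • e + γ • f) e := by
  set D := ⟪e, e⟫ * ⟪f, f⟫ - ⟪e, f⟫ * ⟪e, f⟫ with hD
  have key : ∀ x y : ℝ, 0 ≤ y → Real.sin (InnerProductGeometry.angle (x • e + y • f) e) *
      (‖x • e + y • f‖ * ‖e‖) = y * √D := by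
    intro x y hy
    rw [InnerProductGeometry.sin_angle_mul_norm_mul_norm]
    have h1 : ⟪x • e + y • f, x • e + y • f⟫ * ⟪e, e⟫ -
        ⟪x • e + y • f, e⟫ * ⟪x • e + y • f, e⟫ = y ^ 2 * D := by
      simp only [inner_add_left, inner_add_right, real_inner_smul_left, real_inner_smul_right,
        real_inner_comm e f, hD]
      ring
    rw [h1, Real.sqrt_mul (sq_nonneg y), Real.sqrt_sq hy]
  have key' : ∀ x y : ℝ, Real.cos (InnerProductGeometry.angle (x • e + y • f) e) *
      (‖x • e + y • f‖ * ‖e‖) = x * ⟪e, e⟫ + y * ⟪e, f⟫ := by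
    intro x y
    rw [InnerProductGeometry.cos_angle_mul_norm_mul_norm, inner_add_left,
      real_inner_smul_left, real_inner_smul_left, real_inner_comm e f]
  by_contra! hle
  set a := InnerProductGeometry.angle (β • e + γ • f) e
  set a' := InnerProductGeometry.angle (β' • e + γ' • f) e
  have hs : 0 ≤ Real.sin (a' - a) := by
    refine Real.sin_nonneg_of_nonneg_of_le_pi (sub_nonneg.2 hle) ?_
    have h1 : a' ≤ Real.pi := InnerProductGeometry.angle_le_pi _ _
    have h2 : 0 ≤ a := InnerProductGeometry.angle_nonneg _ _
    linarith
  have he : 0 < ⟪e, e⟫ := by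
    rcases (real_inner_self_nonneg (x := e)).eq_or_lt with h0 | h0
    · rw [hD, ← h0] at hG
      nlinarith [mul_self_nonneg ⟪e, f⟫]
    · exact h0
  have h1 := mul_nonneg hs (mul_nonneg (mul_nonneg (norm_nonneg (β' • e + γ' • f))
    (norm_nonneg e)) (mul_nonneg (norm_nonneg (β • e + γ • f)) (norm_nonneg e)))
  have h2 : Real.sin (a' - a) * (‖β' • e + γ' • f‖ * ‖e‖ * (‖β • e + γ • f‖ * ‖e‖)) =
      √D * ⟪e, e⟫ * (γ' * β - γ * β') := by
    rw [Real.sin_sub]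
    have e1 := key β γ hγ
    have e2 := key β' γ' hγ'
    have e3 := key' β γ
    have e4 := key' β' γ'
    calc _ = (Real.sin a' * (‖β' • e + γ' • f‖ * ‖e‖)) *
          (Real.cos a * (‖β • e + γ • f‖ * ‖e‖)) -
          (Real.cos a' * (‖β' • e + γ' • f‖ * ‖e‖)) *
          (Real.sin a * (‖β • e + γ • f‖ * ‖e‖)) := by ring
      _ = _ := by
        rw [e1, e2, e3, e4]
        ring
  rw [h2] at h1
  have h3 : 0 < √D * ⟪e, e⟫ := mul_pos (Real.sqrt_pos.2 hG) he
  nlinarith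

theorem angle_lt_of_coord (b : AffineBasis (Fin 3) ℝ Plane) {i j k : Fin 3} (hij : i ≠ j)
    (hik : i ≠ k) (hjk : j ≠ k) {p v w : Plane} (hv : b.coord k v ≤ b.coord k p)
    (hw : b.coord k w ≤ b.coord k p)
    (h : (b.coord k p - b.coord k w) * (b.coord j p - b.coord j v) <
      (b.coord k p - b.coord k v) * (b.coord j p - b.coord j w)) :
    InnerProductGeometry.angle (w - p) (b i - b j) <
      InnerProductGeometry.angle (v - p) (b i - b j) := by
  have hz : ∀ z : Plane, z - p = (b.coord j p - b.coord j z) • (b i - b j) +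
      (b.coord k p - b.coord k z) • (b i - b k) := by
    intro z
    rw [sub_eq_smul_add_smul b hjk hij.symm hik.symm p z]
    module
  rw [hz v, hz w]
  refine angle_add_smul_lt ?_ (sub_nonneg.2 hv) (sub_nonneg.2 hw) h
  have := gram_pos b hij hik hjk
  rwa [← neg_sub (b i) (b j), ← neg_sub (b i) (b k), inner_neg_neg, inner_neg_neg,
    inner_neg_neg] at this

/-! ### The regions at a vertex -/

section Regions

variable {b : AffineBasis (Fin 3) ℝ Plane} {S : Set Plane} {p t z : Plane} {i j k : Fin 3}
  {r : ℝ} {x : Plane}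

theorem low_of_negative (hij : i ≠ j) (hik : i ≠ k) (hjk : j ≠ k) (hpt : p ≠ t)
    (hT : IsSmallest b p t r x) (hj : b.coord j t < b.coord j p)
    (hk : b.coord k t < b.coord k p) :
    low b r x i = b.coord i p ∧ low b r x j = b.coord j t ∧ low b r x k = b.coord k t := by
  have h := (isSmallest_iff b hpt r x).1 hT
  have sp := coord_add_eq_one b hij hik hjk p
  have st := coord_add_eq_one b hij hik hjk t
  rw [h, h, h, min_eq_left (by linarith : b.coord i p ≤ b.coord i t), min_eq_right hj.le,
    min_eq_right hk.le]
  exact ⟨rfl, rfl, rfl⟩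

theorem mem_midRegion_iff (hG : GeneralPosition b S) (hij : i ≠ j) (hik : i ≠ k) (hjk : j ≠ k)
    (hp : p ∈ S) (hz : z ∈ S) (hT : IsSmallest b p t r x) (hj : b.coord j t < b.coord j p)
    (hk : b.coord k t < b.coord k p) :
    z ∈ midRegion b p r x i ↔ Mid b p t j k z := by
  have hpt : p ≠ t := by
    rintro rfl
    exact lt_irrefl _ hj
  obtain ⟨li, lj, lk⟩ := low_of_negative hij hik hjk hpt hT hj hk
  rw [midRegion, Set.mem_inter_iff, mem_negCone_iff, mem_triangle_iff b hT.1.1,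
    forall_ne_iff_of_distinct hij hik hjk, forall_iff_of_distinct hij hik hjk, li, lj, lk]
  constructor
  · rintro ⟨⟨hne, h1, h2⟩, -, h4, h5⟩
    exact ⟨lt_of_le_of_ne h1 fun h => hne (hG.eq_of_coord_eq hz hp h).symm,
      lt_of_le_of_ne h2 fun h => hne (hG.eq_of_coord_eq hz hp h).symm, h4, h5⟩
  · rintro ⟨h1, h2, h3, h4⟩
    have sp := coord_add_eq_one b hij hik hjk p
    have sz := coord_add_eq_one b hij hik hjk z
    refine ⟨⟨?_, h1.le, h2.le⟩, by linarith, h3, h4⟩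
    rintro rfl
    exact lt_irrefl _ h1

theorem mem_sideRegion_iff (hG : GeneralPosition b S) {m : Fin 3} (hm : i + m = j)
    (hij : i ≠ j) (hik : i ≠ k)
    (hjk : j ≠ k) (hp : p ∈ S) (hz : z ∈ S) (hT : IsSmallest b p t r x)
    (hj : b.coord j t < b.coord j p) (hk : b.coord k t < b.coord k p) :
    z ∈ sideRegion b p r x i m ↔ b.coord i p < b.coord i z ∧ b.coord k p < b.coord k z ∧
      b.coord j t ≤ b.coord j z := by
  have hpt : p ≠ t := by
    rintro rfl
    exact lt_irrefl _ hj
  obtain ⟨li, lj, lk⟩ := low_of_negative hij hik hjk hpt hT hj hk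
  rw [sideRegion, hm, Set.mem_inter_iff, mem_posCone_iff, mem_triangle_iff b hT.1.1,
    forall_ne_iff_of_distinct hij.symm hjk hik, forall_iff_of_distinct hij hik hjk, li, lj, lk]
  constructor
  · rintro ⟨⟨hne, h1, h2⟩, -, h4, -⟩
    exact ⟨lt_of_le_of_ne h1 fun h => hne (hG.eq_of_coord_eq hp hz h),
      lt_of_le_of_ne h2 fun h => hne (hG.eq_of_coord_eq hp hz h), h4⟩
  · rintro ⟨h1, h2, h3⟩
    refine ⟨⟨?_, h1.le, h2.le⟩, h1.le, h3, by linarith⟩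
    rintro rfl
    exact lt_irrefl _ h1

/-- The point of the cone with the largest coordinate `j` is a neighbour, because a point inside its
triangle would be in the cone and larger still. -/
theorem exists_adj_posCone (hS : S.Finite) (hij : i ≠ j) (hik : i ≠ k) (hjk : j ≠ k)
    (hp : p ∈ S) (hz : z ∈ S) (hi : b.coord i p < b.coord i z) (hk : b.coord k p < b.coord k z) :
    ∃ w, (tdGraph b S).Adj p w ∧ b.coord i p < b.coord i w ∧ b.coord k p < b.coord k w ∧
      b.coord j z ≤ b.coord j w := by
  obtain ⟨w, ⟨hw, hwi, hwk⟩, hmax⟩ := Set.exists_max_image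
    {y | y ∈ S ∧ b.coord i p < b.coord i y ∧ b.coord k p < b.coord k y}
    (fun y => b.coord j y) (hS.subset fun y hy => hy.1) ⟨z, hz, hi, hk⟩
  refine ⟨w, (tdGraph_adj_iff b S p w).2 ⟨?_, hp, hw, fun y hy => ?_⟩, hwi, hwk,
    hmax z ⟨hz, hi, hk⟩⟩
  · rintro rfl
    exact lt_irrefl _ hwi
  by_contra! hc
  have h1 := hc i
  have h2 := hc j
  have h3 := hc k
  have sp := coord_add_eq_one b hij hik hjk p
  have sw := coord_add_eq_one b hij hik hjk w
  rw [min_eq_left hwi.le] at h1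
  rw [min_eq_left hwk.le] at h3
  rw [min_eq_right (by linarith)] at h2
  exact absurd (hmax y ⟨hy, h1, h3⟩) (not_le.2 h2)

/-- The algorithm sees only neighbours, but a region of a positive cone that contains any point of
`S` also contains a neighbour. -/
theorem emptySide_iff (hS : S.Finite) (hG : GeneralPosition b S) {m : Fin 3} (hm : i + m = j)
    (hij : i ≠ j) (hik : i ≠ k) (hjk : j ≠ k) (hp : p ∈ S) (ht : t ∈ S)
    (hT : IsSmallest b p t r x)
    (hj : b.coord j t < b.coord j p) (hk : b.coord k t < b.coord k p) :
    (nbhd (tdGraph b S) 1 p \ {p}) ∩ sideRegion b p r x i m = ∅ ↔ EmptySide b S p t i j k := by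
  rw [Set.eq_empty_iff_forall_notMem]
  constructor
  · intro h z hz hzi hzk
    by_contra! hzj
    obtain ⟨w, hw, hwi, hwk, hwj⟩ := exists_adj_posCone hS hij hik hjk hp hz hzi hzk
    refine h w ⟨(mem_nbhd_one_diff_iff _ _ _).2 hw, ?_⟩
    exact (mem_sideRegion_iff hG hm hij hik hjk hp hw.2.2.1 hT hj hk).2
      ⟨hwi, hwk, hzj.le.trans hwj⟩
  · rintro h z ⟨hz, hzs⟩
    have hadj := (mem_nbhd_one_diff_iff _ _ _).1 hz
    have hzS := hadj.2.2.1
    obtain ⟨h1, h2, h3⟩ := (mem_sideRegion_iff hG hm hij hik hjk hp hzS hT hj hk).1 hzs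
    have := hG.eq_of_coord_eq ht hzS (h3.antisymm (h z hzS h1 h2))
    subst this
    linarith

theorem midRegion_eq_empty_iff (hG : GeneralPosition b S)
    (hij : i ≠ j) (hik : i ≠ k) (hjk : j ≠ k) (hp : p ∈ S)
    (hT : IsSmallest b p t r x)
    (hj : b.coord j t < b.coord j p) (hk : b.coord k t < b.coord k p) :
    (nbhd (tdGraph b S) 1 p \ {p}) ∩ midRegion b p r x i = ∅ ↔
      ∀ w, (tdGraph b S).Adj p w → ¬ Mid b p t j k w := by
  rw [Set.eq_empty_iff_forall_notMem]
  refine forall_congr' fun w => ?_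
  rw [Set.mem_inter_iff, mem_nbhd_one_diff_iff, not_and]
  refine forall_congr' fun hw => not_congr ?_
  exact mem_midRegion_iff hG hij hik hjk hp hw.2.2.1 hT hj hk

/-- Translates the angular choice into the extremal choice of `side_mid_step`. The point of the
middle region with the largest coordinate `k` is a neighbour; were it not `q`, emptiness of
`T^{p,q}` would leave it no larger in coordinate `j`, hence strictly closer in angle. -/
theorem max_of_closestToSide (hS : S.Finite) (hG : GeneralPosition b S) {m : Fin 3}
    (hm : i + m = j)
    (hij : i ≠ j) (hik : i ≠ k) (hjk : j ≠ k) (hp : p ∈ S)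
    (hT : IsSmallest b p t r x)
    (hj : b.coord j t < b.coord j p) (hk : b.coord k t < b.coord k p)
    (hE : EmptySide b S p t i j k) {q : Plane}
    (hq : ClosestToSide b p i m ((nbhd (tdGraph b S) 1 p \ {p}) ∩ midRegion b p r x i) q) :
    (tdGraph b S).Adj p q ∧ Mid b p t j k q ∧
      ∀ y ∈ S, Mid b p t j k y → b.coord k y ≤ b.coord k q := by
  obtain ⟨⟨hqN, hqM⟩, hmin⟩ := hq
  have hadj := (mem_nbhd_one_diff_iff _ _ _).1 hqN
  have hqm := (mem_midRegion_iff hG hij hik hjk hp hadj.2.2.1 hT hj hk).1 hqM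
  refine ⟨hadj, hqm, ?_⟩
  have sp := coord_add_eq_one b hij hik hjk p
  have sq := coord_add_eq_one b hij hik hjk q
  have hqi : b.coord i p < b.coord i q := by linarith [hqm.lt_left, hqm.lt_right]
  have hempty : ∀ y ∈ S, b.coord i p < b.coord i y → b.coord j q < b.coord j y →
      b.coord k y ≤ b.coord k q := by
    intro y hy h1 h2
    obtain ⟨l, hl⟩ := ((tdGraph_adj_iff b S p q).1 hadj).2.2.2 y hy
    rcases eq_or_eq_or_eq hij hik hjk l with rfl | rfl | rfl
    · rw [min_eq_left hqi.le] at hl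
      linarith
    · rw [min_eq_right hqm.lt_left.le] at hl
      linarith
    · exact hl.trans (min_le_right _ _)
  obtain ⟨w, hw, hwm, hwmax⟩ := exists_adj_mid hS hG hij hik hjk hp hE hadj.2.2.1 hqm
    fun y hy h1 h2 => hempty y hy h1 (hqm.lt_left.trans h2)
  have hwq : w = q := by
    by_contra hne
    have sw := coord_add_eq_one b hij hik hjk w
    have h1 := lt_of_le_of_ne (hwmax q hadj.2.2.1 hqm)
      fun h => hne (hG.eq_of_coord_eq hadj.2.2.1 hw.2.2.1 h).symm
    have h2 : b.coord j w ≤ b.coord j q := by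
      by_contra! h
      have := hempty w hw.2.2.1 (by linarith [hwm.lt_left, hwm.lt_right]) h
      linarith
    have h3 := hmin w ⟨(mem_nbhd_one_diff_iff _ _ _).2 hw,
      (mem_midRegion_iff hG hij hik hjk hp hw.2.2.1 hT hj hk).2 hwm⟩
    rw [hm] at h3
    refine absurd h3 (not_le.2 (angle_lt_of_coord b hij hik hjk hqm.lt_right.le
      hwm.lt_right.le ?_))
    have e1 := hqm.lt_left
    have e2 := hwm.lt_right
    nlinarith
  exact hwq ▸ hwmax

/-- Makes the comparisons of distances in the algorithm into comparisons of the costs in `Good`. -/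
theorem dist_corner (hij : i ≠ j) (hik : i ≠ k) (hjk : j ≠ k)
    (hT : IsSmallest b p t r x) (ht : t = corner b r x i)
    (hj : b.coord j t < b.coord j p) (hk : b.coord k t < b.coord k p) :
    dist p (corner b r x j) = (b.coord k p - b.coord k t) * sideLen b i ∧
      dist (corner b r x j) t = (b.coord i t - b.coord i p) * sideLen b k := by
  have hpt : p ≠ t := by
    rintro rfl
    exact lt_irrefl _ hj
  obtain ⟨li, lj, lk⟩ := low_of_negative hij hik hjk hpt hT hj hk
  have ci := coord_corner b r x i j
  have cj := coord_corner b r x j j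
  have ck := coord_corner b r x k j
  rw [if_neg hij, zero_add, li] at ci
  rw [if_neg hjk.symm, zero_add, lk] at ck
  have sp := coord_add_eq_one b hij hik hjk p
  have st := coord_add_eq_one b hij hik hjk t
  constructor
  · rw [dist_eq_of_coord_eq b hik hij hjk.symm ci.symm, ck, abs_sub_comm, abs_of_pos]
    linarith
  · rw [dist_eq_of_coord_eq b hik.symm hjk.symm hij ck, ci, abs_of_pos]
    linarith

end Regions

/-! ### One round of the explicit algorithm -/

section Round

variable {b : AffineBasis (Fin 3) ℝ Plane} {S : Set Plane} {p t q : Plane} {i j k : Fin 3}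
  {c : ℝ}

theorem coord_lt_of_mem_posCone (hG : GeneralPosition b S) (hp : p ∈ S) (hq : q ∈ S)
    (h : q ∈ posCone b p i) {l : Fin 3} (hl : l ≠ i) : b.coord l p < b.coord l q := by
  obtain ⟨hne, h⟩ := (mem_posCone_iff b p q i).1 h
  exact lt_of_le_of_ne (h l hl) fun h => hne (hG.eq_of_coord_eq hp hq h)

theorem coord_lt_of_mem_negCone (hG : GeneralPosition b S) (hp : p ∈ S) (hq : q ∈ S)
    (h : q ∈ negCone b p i) {l : Fin 3} (hl : l ≠ i) : b.coord l q < b.coord l p := by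
  obtain ⟨hne, h⟩ := (mem_negCone_iff b p q i).1 h
  exact lt_of_le_of_ne (h l hl) fun h => hne (hG.eq_of_coord_eq hq hp h).symm

theorem Good.pos_cases (hg : Good b S t p c) (hij : i ≠ j) (hik : i ≠ k) (hjk : j ≠ k)
    (hj : b.coord j p < b.coord j t) (hk : b.coord k p < b.coord k t) :
    (b.coord i p - b.coord i t) * sideLen b k + (b.coord k t - b.coord k p) * sideLen b i ≤ c ∧
    (b.coord i p - b.coord i t) * sideLen b j +
      (b.coord j t - b.coord j p) * sideLen b i ≤ c := by
  cases hg with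
  | arrived h _ => exact absurd (h ▸ hj) (lt_irrefl _)
  | pos i' j' k' hij' hik' hjk' hj' hk' hc hc' =>
    have sp := coord_add_eq_one b hij hik hjk p
    have st := coord_add_eq_one b hij hik hjk t
    have hi : i' = i := by
      rcases eq_or_eq_or_eq hij' hik' hjk' i with h | rfl | rfl
      · exact h.symm
      · linarith
      · linarith
    subst hi
    rcases eq_or_eq_or_eq hij hik hjk j' with rfl | rfl | rfl
    · exact absurd rfl hij'
    · obtain rfl : k' = k := by omega
      exact ⟨hc, hc'⟩
    · obtain rfl : k' = j := by omega
      exact ⟨hc', hc⟩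
  | side i' j' k' hij' hik' hjk' hj' hk' hE hc =>
    rcases eq_or_eq_or_eq hij' hik' hjk' j with rfl | rfl | rfl
    · rcases eq_or_eq_or_eq hij' hik' hjk' k with rfl | rfl | rfl
      · exact absurd rfl hjk
      · linarith
      · linarith
    · linarith
    · linarith
  | any i' j' k' hij' hik' hjk' hj' hk' hc =>
    rcases eq_or_eq_or_eq hij' hik' hjk' j with rfl | rfl | rfl
    · rcases eq_or_eq_or_eq hij' hik' hjk' k with rfl | rfl | rfl
      · exact absurd rfl hjk
      · linarith
      · linarith
    · linarith
    · linarith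

theorem Good.neg_cases (hg : Good b S t p c) (hij : i ≠ j) (hik : i ≠ k) (hjk : j ≠ k)
    (hj : b.coord j t < b.coord j p) (hk : b.coord k t < b.coord k p) :
    (EmptySide b S p t i j k ∧ (b.coord k p - b.coord k t) * sideLen b i +
        (b.coord i t - b.coord i p) * sideLen b k ≤ c) ∨
    (EmptySide b S p t i k j ∧ (b.coord j p - b.coord j t) * sideLen b i +
        (b.coord i t - b.coord i p) * sideLen b j ≤ c) ∨
    (b.coord i t - b.coord i p) * (sideLen b i + sideLen b j) +
        (b.coord k p - b.coord k t) * sideLen b i ≤ c ∨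
    (b.coord i t - b.coord i p) * (sideLen b i + sideLen b k) +
        (b.coord j p - b.coord j t) * sideLen b i ≤ c := by
  have sp := coord_add_eq_one b hij hik hjk p
  have st := coord_add_eq_one b hij hik hjk t
  have key : ∀ i' j' k' : Fin 3, i' ≠ j' → i' ≠ k' → j' ≠ k' → b.coord j' t < b.coord j' p →
      b.coord k' t < b.coord k' p → i' = i ∧ (j' = j ∧ k' = k ∨ j' = k ∧ k' = j) := by
    intro i' j' k' hij' hik' hjk' hj' hk'
    have hi : i' = i := by
      rcases eq_or_eq_or_eq hij' hik' hjk' i with h | rfl | rfl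
      · exact h.symm
      · linarith
      · linarith
    omega
  cases hg with
  | arrived h _ => exact absurd (h ▸ hj) (lt_irrefl _)
  | pos i' j' k' hij' hik' hjk' hj' hk' hc hc' =>
    rcases eq_or_eq_or_eq hij' hik' hjk' j with rfl | rfl | rfl
    · rcases eq_or_eq_or_eq hij' hik' hjk' k with rfl | rfl | rfl
      · exact absurd rfl hjk
      · linarith
      · linarith
    · linarith
    · linarith
  | side i' j' k' hij' hik' hjk' hj' hk' hE hc =>
    obtain ⟨rfl, ⟨rfl, rfl⟩ | ⟨rfl, rfl⟩⟩ := key i' j' k' hij' hik' hjk' hj' hk'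
    · exact Or.inl ⟨hE, hc⟩
    · exact Or.inr (Or.inl ⟨hE, hc⟩)
  | any i' j' k' hij' hik' hjk' hj' hk' hc =>
    obtain ⟨rfl, ⟨rfl, rfl⟩ | ⟨rfl, rfl⟩⟩ := key i' j' k' hij' hik' hjk' hj' hk'
    · exact Or.inr (Or.inr (Or.inl hc))
    · exact Or.inr (Or.inr (Or.inr hc))

/-- The walk `p → τ_j → t` is no longer than either three-sided walk, so knowledge of an empty side
can replace a cost of type `any`. Only a cost for the opposite empty side needs the hypothesis `h`.
-/
theorem Good.side_bound (hg : Good b S t p c) (hij : i ≠ j) (hik : i ≠ k) (hjk : j ≠ k)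
    (hj : b.coord j t < b.coord j p) (hk : b.coord k t < b.coord k p)
    (h : EmptySide b S p t i k j → (b.coord k p - b.coord k t) * sideLen b i +
        (b.coord i t - b.coord i p) * sideLen b k ≤ (b.coord j p - b.coord j t) * sideLen b i +
        (b.coord i t - b.coord i p) * sideLen b j) :
    (b.coord k p - b.coord k t) * sideLen b i +
        (b.coord i t - b.coord i p) * sideLen b k ≤ c := by
  have sp := coord_add_eq_one b hij hik hjk p
  have st := coord_add_eq_one b hij hik hjk t
  have h1 := mul_le_mul_of_nonneg_left (sideLen_le_add b hij hik hjk)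
    (show 0 ≤ b.coord i t - b.coord i p by linarith)
  have h2 := mul_le_mul_of_nonneg_right
    (show b.coord k p - b.coord k t ≤ b.coord i t - b.coord i p by linarith)
    (sideLen_pos b i).le
  have h3 := mul_nonneg (show 0 ≤ b.coord j p - b.coord j t by linarith) (sideLen_pos b i).le
  rcases hg.neg_cases hij hik hjk hj hk with ⟨-, hc⟩ | ⟨hE, hc⟩ | hc | hc
  · exact hc
  · exact (h hE).trans hc
  · linarith
  · linarith

theorem distinct_add_sub {m : Fin 3} (hm : m = 1 ∨ m = -1) (i : Fin 3) :
    i ≠ i + m ∧ i ≠ i - m ∧ i + m ≠ i - m := by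
  rcases hm with rfl | rfl <;> revert i <;> decide

/-- The invariant of the algorithm. Each kind of round first brings the cost to the form that fits
its choice of the next vertex, then applies the matching step above. -/
theorem Good.algStep (hS : S.Finite) (hG : GeneralPosition b S) (hp : p ∈ S) (ht : t ∈ S)
    (hg : Good b S t p c)
    (hA : AlgStep b p (nbhd (tdGraph b S) 1 p \ {p}) t q) :
    (tdGraph b S).Adj p q ∧ Good b S t q (c - dist p q) := by
  have hneg : ∀ {i : Fin 3} {r : ℝ} {x : Plane}, IsSmallest b p t r x → t = corner b r x i →
      ∀ l, l ≠ i → b.coord l t < b.coord l p := fun hT ht' l hl =>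
    coord_lt_of_mem_negCone hG hp ht ⟨_, _, hT, ht'⟩ hl
  cases hA with
  | posCase i _ hti hv hvi =>
    have hadj := (mem_nbhd_one_diff_iff _ _ _).1 hv
    obtain ⟨hij, hik, hjk⟩ := distinct_add_sub (Or.inl rfl) i
    have hj := coord_lt_of_mem_posCone hG hp ht hti hij.symm
    have hk := coord_lt_of_mem_posCone hG hp ht hti hik.symm
    obtain ⟨hc, hc'⟩ := hg.pos_cases hij hik hjk hj hk
    exact ⟨hadj, Good.pos_step hG ht hij hik hjk hj hk hc hc' hadj
      (coord_lt_of_mem_posCone hG hp hadj.2.2.1 hvi hij.symm)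
      (coord_lt_of_mem_posCone hG hp hadj.2.2.1 hvi hik.symm)⟩
  | bothEmpty i m r x _ hT htc hm h₁ h₂ hmin hv =>
    obtain ⟨hij, hik, hjk⟩ := distinct_add_sub hm i
    have hj := hneg hT htc _ hij.symm
    have hk := hneg hT htc _ hik.symm
    have hE : EmptySide b S p t i (i + m) (i - m) := by
      refine (emptySide_iff hS hG rfl hij hik hjk hp ht hT hj hk).1 ?_
      rcases hm with rfl | rfl <;> assumption
    obtain ⟨d1, d2⟩ := dist_corner hij hik hjk hT htc hj hk
    obtain ⟨d3, d4⟩ := dist_corner hik hij hjk.symm hT htc hk hj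
    rw [d1, d2, d3, d4] at hmin
    obtain ⟨h1, h2, h3⟩ := max_of_closestToSide hS hG rfl hij hik hjk hp hT hj hk hE hv
    exact ⟨h1, Good.side_mid_step hG hp ht hij hik hjk hE
      (hg.side_bound hij hik hjk hj hk fun _ => hmin) h1 h2 h3⟩
  | oneEmptyMid i m r x _ hT htc hm h₁ h₂ hv =>
    obtain ⟨hij, hik, hjk⟩ := distinct_add_sub hm i
    have hj := hneg hT htc _ hij.symm
    have hk := hneg hT htc _ hik.symm
    have hE := (emptySide_iff hS hG rfl hij hik hjk hp ht hT hj hk).1 h₁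
    have hE' : ¬ EmptySide b S p t i (i - m) (i + m) := by
      rw [← emptySide_iff hS hG (sub_eq_add_neg i m).symm hik hij hjk.symm hp ht hT hk hj]
      exact h₂.ne_empty
    obtain ⟨h1, h2, h3⟩ := max_of_closestToSide hS hG rfl hij hik hjk hp hT hj hk hE hv
    exact ⟨h1, Good.side_mid_step hG hp ht hij hik hjk hE
      (hg.side_bound hij hik hjk hj hk fun h => absurd h hE') h1 h2 h3⟩
  | oneEmptySide i m r x _ hT htc hm h₁ hM hv =>
    obtain ⟨hij, hik, hjk⟩ := distinct_add_sub hm i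
    have hj := hneg hT htc _ hij.symm
    have hk := hneg hT htc _ hik.symm
    have hE := (emptySide_iff hS hG rfl hij hik hjk hp ht hT hj hk).1 h₁
    have hE' : ¬ EmptySide b S p t i (i - m) (i + m) := by
      rw [← emptySide_iff hS hG (sub_eq_add_neg i m).symm hik hij hjk.symm hp ht hT hk hj]
      exact Set.Nonempty.ne_empty ⟨q, hv⟩
    rw [midRegion_eq_empty_iff hG hij hik hjk hp hT hj hk] at hM
    have hadj := (mem_nbhd_one_diff_iff _ _ _).1 hv.1
    obtain ⟨h1, h2, h3⟩ := (mem_sideRegion_iff hG (sub_eq_add_neg i m).symm hik hij hjk.symm hp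
      hadj.2.2.1 hT hk hj).1 hv.2
    exact ⟨hadj, Good.side_side_step hS hG hp ht hij hik hjk hj hE
      (hg.side_bound hij hik hjk hj hk fun h => absurd h hE') hM hadj h1 h2 h3⟩
  | noneEmptyMid i r x _ hT htc h₁ h₂ hv =>
    obtain ⟨hij, hik, hjk⟩ := distinct_add_sub (Or.inl rfl) i
    have hj := hneg hT htc _ hij.symm
    have hk := hneg hT htc _ hik.symm
    have hE : ¬ EmptySide b S p t i (i + 1) (i - 1) := by
      rw [← emptySide_iff hS hG rfl hij hik hjk hp ht hT hj hk]
      exact h₁.ne_empty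
    have hE' : ¬ EmptySide b S p t i (i - 1) (i + 1) := by
      rw [← emptySide_iff hS hG (sub_eq_add_neg i 1).symm hik hij hjk.symm hp ht hT hk hj]
      exact h₂.ne_empty
    have hadj := (mem_nbhd_one_diff_iff _ _ _).1 hv.1
    have hmid := (mem_midRegion_iff hG hij hik hjk hp hadj.2.2.1 hT hj hk).1 hv.2
    refine ⟨hadj, ?_⟩
    rcases hg.neg_cases hij hik hjk hj hk with ⟨h, -⟩ | ⟨h, -⟩ | hc | hc
    · exact absurd h hE
    · exact absurd h hE'
    · exact Good.any_mid_step hG ht hij hik hjk hc hadj hmid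
    · exact Good.any_mid_step hG ht hik hij hjk.symm hc hadj hmid.symm
  | noneEmptySide i m r x _ hT htc hm h₁ hM hmin hv =>
    obtain ⟨hij, hik, hjk⟩ := distinct_add_sub hm i
    have hj := hneg hT htc _ hij.symm
    have hk := hneg hT htc _ hik.symm
    have hE : ¬ EmptySide b S p t i (i + m) (i - m) := by
      rw [← emptySide_iff hS hG rfl hij hik hjk hp ht hT hj hk]
      exact h₁.ne_empty
    have hE' : ¬ EmptySide b S p t i (i - m) (i + m) := by
      rw [← emptySide_iff hS hG (sub_eq_add_neg i m).symm hik hij hjk.symm hp ht hT hk hj]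
      exact Set.Nonempty.ne_empty ⟨q, hv⟩
    obtain ⟨d1, d2⟩ := dist_corner hij hik hjk hT htc hj hk
    obtain ⟨d3, d4⟩ := dist_corner hik hij hjk.symm hT htc hk hj
    rw [d1, d2, d3, d4] at hmin
    have hadj := (mem_nbhd_one_diff_iff _ _ _).1 hv.1
    obtain ⟨h1, h2, h3⟩ := (mem_sideRegion_iff hG (sub_eq_add_neg i m).symm hik hij hjk.symm hp
      hadj.2.2.1 hT hk hj).1 hv.2
    refine ⟨hadj, Good.any_side_step hG ht hij hik hjk hj ?_ hadj h1 h2 h3⟩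
    rcases hg.neg_cases hij hik hjk hj hk with ⟨h, -⟩ | ⟨h, -⟩ | hc | hc
    · exact absurd h hE
    · exact absurd h hE'
    · exact hc
    -- The walk that visits the corners in the other order costs at least as much, by the choice of
    -- `m` in `hmin`.
    · linarith

/-- A permitted next vertex always exists. -/
theorem exists_algStep (hS : S.Finite) (hG : GeneralPosition b S) (hp : p ∈ S) (ht : t ∈ S)
    (hpt : p ≠ t) : ∃ q, AlgStep b p (nbhd (tdGraph b S) 1 p \ {p}) t q := by
  have hne := (generalPosition_iff b S).1 hG p hp t ht hpt
  have hcases : ∃ i : Fin 3, (∀ l, l ≠ i → b.coord l p < b.coord l t) ∨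
      ∀ l, l ≠ i → b.coord l t < b.coord l p := by
    simp only [Fin.forall_fin_succ, Fin.exists_fin_succ]
    rcases lt_or_gt_of_ne (hne 0) with h0 | h0 <;> rcases lt_or_gt_of_ne (hne 1) with h1 | h1 <;>
      rcases lt_or_gt_of_ne (hne 2) with h2 | h2 <;> simp [h0, h1, h2]
  obtain ⟨i, hpos | hneg⟩ := hcases
  · obtain ⟨hij, hik, hjk⟩ := distinct_add_sub (Or.inl rfl) i
    obtain ⟨w, hw, hwj, hwk, -⟩ := exists_adj_posCone hS hij.symm hjk hik hp ht
      (hpos _ hij.symm) (hpos _ hik.symm)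
    refine ⟨w, AlgStep.posCase i w ?_ ((mem_nbhd_one_diff_iff _ _ _).2 hw) ?_⟩
    · exact (mem_posCone_iff b p t i).2 ⟨hpt, fun l hl => (hpos l hl).le⟩
    · rw [mem_posCone_iff, forall_ne_iff_of_distinct hij hik hjk]
      exact ⟨hw.1, hwj.le, hwk.le⟩
  · obtain ⟨r, x, hlow⟩ := exists_low_eq_min b p t
    have hT := (isSmallest_iff b hpt r x).2 hlow
    have htc : t = corner b r x i :=
      (eq_corner_right_iff b hlow i).2 fun l hl => (hneg l hl).le
    set N := nbhd (tdGraph b S) 1 p \ {p} with hN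
    have hfin : ∀ X : Set Plane, (N ∩ X).Finite := fun X => hS.subset fun z hz =>
      ((mem_nbhd_one_diff_iff _ _ _).1 hz.1).2.2.1
    have hclosest : ∀ m : Fin 3, (N ∩ midRegion b p r x i).Nonempty →
        ∃ v, ClosestToSide b p i m (N ∩ midRegion b p r x i) v := fun m h =>
      Set.exists_min_image _ (fun v => InnerProductGeometry.angle (v - p) (b i - b (i + m)))
        (hfin _) h
    have hone : ∀ m : Fin 3, m = 1 ∨ m = -1 → N ∩ sideRegion b p r x i m = ∅ →
        (N ∩ sideRegion b p r x i (-m)).Nonempty → ∃ q, AlgStep b p N t q := by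
      intro m hm h1 h2
      rcases Set.eq_empty_or_nonempty (N ∩ midRegion b p r x i) with hM | hM
      · obtain ⟨v, hv⟩ := h2
        exact ⟨v, AlgStep.oneEmptySide i m r x v hT htc hm h1 hM hv⟩
      · obtain ⟨v, hv⟩ := hclosest m hM
        exact ⟨v, AlgStep.oneEmptyMid i m r x v hT htc hm h1 h2 hv⟩
    rcases Set.eq_empty_or_nonempty (N ∩ sideRegion b p r x i 1) with h1 | h1 <;>
      rcases Set.eq_empty_or_nonempty (N ∩ sideRegion b p r x i (-1)) with h2 | h2
    · obtain ⟨hij, hik, hjk⟩ := distinct_add_sub (Or.inl rfl) i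
      have hj := hneg _ hij.symm
      have hk := hneg _ hik.symm
      have hE := (emptySide_iff hS hG rfl hij hik hjk hp ht hT hj hk).1 h1
      have hE' := (emptySide_iff hS hG (sub_eq_add_neg i 1).symm hik hij hjk.symm hp ht hT hk
        hj).1 h2
      have hM : (N ∩ midRegion b p r x i).Nonempty := by
        -- With both side regions empty, `t` itself shows that the middle region contains points,
        -- and emptiness turns one into a neighbour.
        obtain ⟨w, hw, hwm, -⟩ := exists_adj_mid hS hG hij hik hjk hp hE ht
          ⟨hj, hk, le_rfl, le_rfl⟩ hE'
        exact ⟨w, (mem_nbhd_one_diff_iff _ _ _).2 hw,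
          (mem_midRegion_iff hG hij hik hjk hp hw.2.2.1 hT hj hk).2 hwm⟩
      have hmin : ∃ m : Fin 3, (m = 1 ∨ m = -1) ∧
          dist p (corner b r x (i + m)) + dist (corner b r x (i + m)) t ≤
          dist p (corner b r x (i - m)) + dist (corner b r x (i - m)) t := by
        rcases le_total (dist p (corner b r x (i + 1)) + dist (corner b r x (i + 1)) t)
          (dist p (corner b r x (i - 1)) + dist (corner b r x (i - 1)) t) with h | h
        · exact ⟨1, Or.inl rfl, h⟩
        · refine ⟨-1, Or.inr rfl, ?_⟩
          rwa [sub_neg_eq_add, ← sub_eq_add_neg]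
      obtain ⟨m, hm, hmin⟩ := hmin
      obtain ⟨v, hv⟩ := hclosest m hM
      exact ⟨v, AlgStep.bothEmpty i m r x v hT htc hm h1 h2 hmin hv⟩
    · exact hone 1 (Or.inl rfl) h1 h2
    · exact hone (-1) (Or.inr rfl) h2 (by rwa [neg_neg])
    · rcases Set.eq_empty_or_nonempty (N ∩ midRegion b p r x i) with hM | ⟨v, hv⟩
      · rcases le_total (dist p (corner b r x (i + 1)) + dist (corner b r x (i - 1)) t)
          (dist p (corner b r x (i - 1)) + dist (corner b r x (i + 1)) t) with h | h
        · obtain ⟨v, hv⟩ := h2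
          exact ⟨v, AlgStep.noneEmptySide i 1 r x v hT htc (Or.inl rfl) h1 hM h hv⟩
        · obtain ⟨v, hv⟩ := h1
          refine ⟨v, AlgStep.noneEmptySide i (-1) r x v hT htc (Or.inr rfl) h2 hM ?_
            (by rwa [neg_neg])⟩
          rwa [sub_neg_eq_add, ← sub_eq_add_neg]
      · exact ⟨v, AlgStep.noneEmptyMid i r x v hT htc h1 h2 hv⟩

end Round

theorem exists_implements (b : AffineBasis (Fin 3) ℝ Plane) :
    ∃ A : RoutingAlgorithm Unit, A.Implements b := by
  classical
  refine ⟨⟨(), fun p N t _ => (if h : ∃ q, AlgStep b p (N \ {p}) t q then h.choose else p, ())⟩,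
    fun S hS hG p hp t ht hpt => ?_⟩
  have h := exists_algStep hS hG hp ht hpt
  simp only [dif_pos h]
  exact h.choose_spec

/-! ### The length of the path of the explicit algorithm -/

theorem RoutingAlgorithm.state_succ_eq (A : RoutingAlgorithm Unit) (G : SimpleGraph Plane)
    (k : ℕ) (s t : Plane) (n : ℕ) :
    A.state G k s t (n + 1) = A.state G k (A.step s (nbhd G k s) t ()).1 t n := by
  induction n with
  | zero => rfl
  | succ n ih =>
    rw [RoutingAlgorithm.state, ih]
    rfl

theorem RoutingAlgorithm.RoutesWithin.cons {A : RoutingAlgorithm Unit} {G : SimpleGraph Plane}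
    {k : ℕ} {s t : Plane} {L : ℝ} (hs : (A.step s (nbhd G k s) t ()).1 ∈ nbhd G 1 s)
    (h : A.RoutesWithin G k (A.step s (nbhd G k s) t ()).1 t
      (L - dist s (A.step s (nbhd G k s) t ()).1)) : A.RoutesWithin G k s t L := by
  obtain ⟨n, h1, h2, h3⟩ := h
  refine ⟨n + 1, ?_, ?_, ?_⟩
  · rw [A.state_succ_eq, h1]
  · intro i hi
    cases i with
    | zero => exact hs
    | succ i =>
      rw [A.state_succ_eq, A.state_succ_eq]
      exact h2 i (by omega)
  · rw [Finset.sum_range_succ']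
    rw [Finset.sum_congr rfl fun i _ => by
      rw [A.state_succ_eq G k s t i, A.state_succ_eq G k s t (i + 1)]]
    change _ + dist s (A.step s (nbhd G k s) t ()).1 ≤ L
    linarith

/-- Each edge has length at least the minimal distance `δ` in `S`, and the budget stays
non-negative, so fewer than `c / δ + 1` edges are used. -/
theorem Good.routesWithin {b : AffineBasis (Fin 3) ℝ Plane} {S : Set Plane} (hS : S.Finite)
    (hG : GeneralPosition b S) {A : RoutingAlgorithm Unit} (hA : A.Implements b) {s t : Plane}
    (hs : s ∈ S) (ht : t ∈ S) {c : ℝ} (hg : Good b S t s c) :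
    A.RoutesWithin (tdGraph b S) 1 s t c := by
  obtain ⟨δ, hδ, hmin⟩ : ∃ δ > 0, ∀ u ∈ S, ∀ v ∈ S, u ≠ v → δ ≤ dist u v := by
    have hfin : ((fun z : Plane × Plane => dist z.1 z.2) '' (S ×ˢ S) \ {0}).Finite :=
      ((hS.prod hS).image _).sdiff
    rcases Set.eq_empty_or_nonempty ((fun z : Plane × Plane => dist z.1 z.2) '' (S ×ˢ S) \ {0})
      with he | hne
    · refine ⟨1, one_pos, fun u hu v hv huv => ?_⟩
      have : dist u v ∈ (fun z : Plane × Plane => dist z.1 z.2) '' (S ×ˢ S) \ {0} :=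
        ⟨⟨(u, v), ⟨hu, hv⟩, rfl⟩, dist_ne_zero.2 huv⟩
      rw [he] at this
      exact this.elim
    · obtain ⟨δ, ⟨⟨z, hz, rfl⟩, hδ⟩, hmin⟩ := Set.exists_min_image _ id hfin hne
      refine ⟨dist z.1 z.2, lt_of_le_of_ne dist_nonneg (Ne.symm hδ), fun u hu v hv huv => ?_⟩
      exact hmin (dist u v) ⟨⟨(u, v), ⟨hu, hv⟩, rfl⟩, dist_ne_zero.2 huv⟩
  have key : ∀ (n : ℕ) (c : ℝ) (s : Plane), s ∈ S → Good b S t s c → c < n * δ →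
      A.RoutesWithin (tdGraph b S) 1 s t c := by
    intro n
    induction n with
    | zero =>
      intro c s _ hg hc
      have := hg.nonneg
      rw [Nat.cast_zero, zero_mul] at hc
      linarith
    | succ n ih =>
      intro c s hs hg hc
      by_cases hst : s = t
      · exact ⟨0, hst, fun i hi => absurd hi (Nat.not_lt_zero i), by simpa using hg.nonneg⟩
      obtain ⟨hadj, hg'⟩ := hg.algStep hS hG hs ht (hA S hS hG s hs t ht hst)
      refine RoutingAlgorithm.RoutesWithin.cons ((mem_nbhd_one_iff _ _ _).2 (Or.inr hadj))
        (ih _ _ hadj.2.2.1 hg' ?_)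
      have := hmin s hs _ hadj.2.2.1 hadj.1
      push_cast at hc
      linarith
  obtain ⟨n, hn⟩ := exists_nat_gt (c / δ)
  exact key n c s hs hg ((div_lt_iff₀ hδ).1 hn)

/-! ### The constant and the geometry of the triangle -/

open RealInnerProductSpace in
/-- For a point `s = t + (1 - y) X + y Y` on the side opposite to `t` of the triangle with the
corners `t`, `t + X`, `t + Y`. -/
theorem detour_expression {V : Type*} [NormedAddCommGroup V] [InnerProductSpace ℝ V] {X Y : V}
    (hG : 0 < ⟪Y, Y⟫ * ⟪X, X⟫ - ⟪Y, X⟫ * ⟪Y, X⟫) {y : ℝ} (hy₀ : 0 ≤ y) (hy₁ : y ≤ 1)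
    {Z : V} (hZ : Z = (1 - y) • X + y • Y) {α A B C : ℝ}
    (hα : α = InnerProductGeometry.angle X Z) (hA : A = InnerProductGeometry.angle Y X)
    (hB : B = InnerProductGeometry.angle (-X) (Y - X))
    (hC : C = InnerProductGeometry.angle (X - Y) (-Y)) :
    α ≤ A ∧ (Real.sin (A - α) / Real.sin C + Real.sin α / Real.sin B +
      min (Real.sin α / Real.sin B + Real.sin (α + B) / Real.sin C)
        (Real.sin (A - α) / Real.sin C + Real.sin (α + B) / Real.sin B)) * ‖Z‖ =
      ‖Y - X‖ + min (y * ‖Y - X‖ + ‖Y‖) ((1 - y) * ‖Y - X‖ + ‖X‖) := by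
  set D := ⟪Y, Y⟫ * ⟪X, X⟫ - ⟪Y, X⟫ * ⟪Y, X⟫ with hD
  set G := √D with hGdef
  have hG0 : 0 < G := Real.sqrt_pos.2 hG
  -- `G` is twice the area of the triangle; every sine below is an area divided by two lengths, and
  -- dividing two of them is the law of sines.
  have hsin : ∀ (u v : V) (a : ℝ), 0 ≤ a → ⟪u, u⟫ * ⟪v, v⟫ - ⟪u, v⟫ * ⟪u, v⟫ = a ^ 2 * D →
      Real.sin (InnerProductGeometry.angle u v) * (‖u‖ * ‖v‖) = a * G := by
    intro u v a ha h
    rw [InnerProductGeometry.sin_angle_mul_norm_mul_norm, h, Real.sqrt_mul (sq_nonneg a),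
      Real.sqrt_sq ha]
  have sA : Real.sin A * (‖Y‖ * ‖X‖) = 1 * G := by
    rw [hA]
    exact hsin _ _ 1 zero_le_one (by rw [hD]; ring)
  have sB : Real.sin B * (‖X‖ * ‖Y - X‖) = 1 * G := by
    rw [hB, ← norm_neg X]
    refine hsin _ _ 1 zero_le_one ?_
    simp only [inner_sub_left, inner_sub_right, inner_neg_left, inner_neg_right,
      real_inner_comm Y X, hD]
    ring
  have sC : Real.sin C * (‖Y - X‖ * ‖Y‖) = 1 * G := by
    rw [hC, ← norm_neg Y, norm_sub_rev]
    refine hsin _ _ 1 zero_le_one ?_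
    simp only [inner_sub_left, inner_sub_right, inner_neg_left, inner_neg_right,
      real_inner_comm Y X, hD]
    ring
  have sα : Real.sin α * (‖X‖ * ‖Z‖) = y * G := by
    rw [hα]
    refine hsin _ _ y hy₀ ?_
    simp only [hZ, inner_add_left, inner_add_right, real_inner_smul_left, real_inner_smul_right,
      real_inner_comm Y X, hD]
    ring
  have cA : Real.cos A * (‖Y‖ * ‖X‖) = ⟪Y, X⟫ := by
    rw [hA, InnerProductGeometry.cos_angle_mul_norm_mul_norm]
  have cB : Real.cos B * (‖X‖ * ‖Y - X‖) = ⟪X, X⟫ - ⟪Y, X⟫ := by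
    rw [hB, ← norm_neg X, InnerProductGeometry.cos_angle_mul_norm_mul_norm]
    simp only [inner_sub_right, inner_neg_left, real_inner_comm Y X]
    ring
  have cα : Real.cos α * (‖X‖ * ‖Z‖) = (1 - y) * ⟪X, X⟫ + y * ⟪Y, X⟫ := by
    rw [hα, InnerProductGeometry.cos_angle_mul_norm_mul_norm]
    simp only [hZ, inner_add_right, real_inner_smul_right, real_inner_comm Y X]
  have hX : 0 < ‖X‖ := by
    refine norm_pos_iff.2 ?_
    rintro rfl
    simp at sA
    exact hG0.ne sA
  have hY : 0 < ‖Y‖ := by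
    refine norm_pos_iff.2 ?_
    rintro rfl
    simp at sA
    exact hG0.ne sA
  have hYX : 0 < ‖Y - X‖ := by
    rcases (norm_nonneg (Y - X)).eq_or_lt with h | h
    · rw [← h] at sB
      simp at sB
      exact absurd sB hG0.ne
    · exact h
  have hXX : ⟪X, X⟫ = ‖X‖ * ‖X‖ := real_inner_self_eq_norm_mul_norm X
  have hZpos : 0 < ‖Z‖ := by
    rcases (norm_nonneg Z).eq_or_lt with h | h
    · rw [← h] at sα cα
      have hy : y = 0 := by
        simp only [mul_zero] at sα
        exact (mul_eq_zero.1 sα.symm).resolve_right hG0.ne'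
      rw [hy, hXX] at cα
      nlinarith
    · exact h
  have sAα : Real.sin (A - α) * (‖Y‖ * ‖Z‖) = (1 - y) * G := by
    have : Real.sin (A - α) * (‖Y‖ * ‖Z‖) * (‖X‖ * ‖X‖) = (1 - y) * G * (‖X‖ * ‖X‖) := by
      rw [Real.sin_sub, ← hXX]
      calc _ = Real.sin A * (‖Y‖ * ‖X‖) * (Real.cos α * (‖X‖ * ‖Z‖)) -
            Real.cos A * (‖Y‖ * ‖X‖) * (Real.sin α * (‖X‖ * ‖Z‖)) := by rw [hXX]; ring
        _ = _ := by
          rw [sA, cA, cα, sα]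
          ring
    exact mul_right_cancel₀ (mul_pos hX hX).ne' this
  have sαB : Real.sin (α + B) * (‖Z‖ * ‖Y - X‖) = G := by
    have : Real.sin (α + B) * (‖Z‖ * ‖Y - X‖) * (‖X‖ * ‖X‖) = G * (‖X‖ * ‖X‖) := by
      rw [Real.sin_add, ← hXX]
      calc _ = Real.sin α * (‖X‖ * ‖Z‖) * (Real.cos B * (‖X‖ * ‖Y - X‖)) +
            Real.cos α * (‖X‖ * ‖Z‖) * (Real.sin B * (‖X‖ * ‖Y - X‖)) := by rw [hXX]; ring
        _ = _ := by
          rw [sα, cB, cα, sB]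
          ring
    exact mul_right_cancel₀ (mul_pos hX hX).ne' this
  have hsB : 0 < Real.sin B := by
    by_contra! h
    nlinarith [mul_pos hX hYX]
  have hsC : 0 < Real.sin C := by
    by_contra! h
    nlinarith [mul_pos hYX hY]
  constructor
  · by_contra! h
    have h1 : Real.sin (A - α) < 0 := by
      refine Real.sin_neg_of_neg_of_neg_pi_lt (by linarith) ?_
      have h2 : α ≤ Real.pi := hα ▸ InnerProductGeometry.angle_le_pi _ _
      have h3 : 0 < A := by
        rcases (hA ▸ InnerProductGeometry.angle_nonneg Y X : 0 ≤ A).eq_or_lt with h3 | h3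
        · rw [← h3, Real.sin_zero, zero_mul, one_mul] at sA
          exact absurd sA hG0.ne
        · exact h3
      linarith
    have := mul_neg_of_neg_of_pos h1 (mul_pos hY hZpos)
    nlinarith
  · have r1 : Real.sin α / Real.sin B * ‖Z‖ = y * ‖Y - X‖ := by
      rw [div_mul_eq_mul_div, div_eq_iff hsB.ne']
      refine mul_right_cancel₀ hX.ne' ?_
      linear_combination sα - y * sB
    have r2 : Real.sin (A - α) / Real.sin C * ‖Z‖ = (1 - y) * ‖Y - X‖ := by
      rw [div_mul_eq_mul_div, div_eq_iff hsC.ne']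
      refine mul_right_cancel₀ hY.ne' ?_
      linear_combination sAα - (1 - y) * sC
    have r3 : Real.sin (α + B) / Real.sin C * ‖Z‖ = ‖Y‖ := by
      rw [div_mul_eq_mul_div, div_eq_iff hsC.ne']
      refine mul_right_cancel₀ hYX.ne' ?_
      linear_combination sαB - sC
    have r4 : Real.sin (α + B) / Real.sin B * ‖Z‖ = ‖X‖ := by
      rw [div_mul_eq_mul_div, div_eq_iff hsB.ne']
      refine mul_right_cancel₀ hYX.ne' ?_
      linear_combination sαB - sB
    rw [add_mul, min_mul_of_nonneg _ _ hZpos.le, add_mul, add_mul, add_mul, r1, r2, r3, r4]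
    ring

/-- The direction from the corner `i` to the point that divides the opposite side in the ratio
`y : 1 - y`. -/
noncomputable def chord (b : AffineBasis (Fin 3) ℝ Plane) (i : Fin 3) (y : ℝ) : Plane :=
  (1 - y) • (b (i - 1) - b i) + y • (b (i + 1) - b i)

theorem chord_ne_zero (b : AffineBasis (Fin 3) ℝ Plane) (i : Fin 3) (y : ℝ) :
    chord b i y ≠ 0 := by
  obtain ⟨hij, hik, hjk⟩ := distinct_add_sub (m := 1) (Or.inl rfl) i
  have h1 : ∀ l m : Fin 3, (b.coord l).linear (b m - b i) =
      b.coord l (b m) - b.coord l (b i) := fun l m => (b.coord l).linearMap_vsub (b m) (b i)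
  intro h
  have h2 := congrArg (b.coord i).linear h
  rw [chord, map_add, map_smul, map_smul, h1, h1, map_zero, b.coord_apply_eq,
    b.coord_apply_ne hij, b.coord_apply_ne hik] at h2
  simp only [smul_eq_mul] at h2
  linarith

/-- The angles `θ` are those of the triangle. -/
def IsAngles (b : AffineBasis (Fin 3) ℝ Plane) (θ : Fin 3 → ℝ) : Prop :=
  ∀ i, θ i = InnerProductGeometry.angle (b (i + 1) - b i) (b (i - 1) - b i)

theorem IsAngles.eq_angle {b : AffineBasis (Fin 3) ℝ Plane} {θ : Fin 3 → ℝ}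
    (hθ : IsAngles b θ) {i j k : Fin 3} (hij : i ≠ j) (hik : i ≠ k) (hjk : j ≠ k) :
    θ i = InnerProductGeometry.angle (b j - b i) (b k - b i) := by
  have h : j = i + 1 ∧ k = i - 1 ∨ j = i - 1 ∧ k = i + 1 := by
    revert i j k
    decide
  rcases h with ⟨rfl, rfl⟩ | ⟨rfl, rfl⟩
  · exact hθ i
  · rw [InnerProductGeometry.angle_comm]
    exact hθ i

/-- Identifies the trigonometric expression as the length of the shorter three-sided walk divided by
the distance, for `t` at the corner `i` and `s` on the opposite side. -/
theorem detourRatio_mul_norm_chord {b : AffineBasis (Fin 3) ℝ Plane} {θ : Fin 3 → ℝ}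
    (hθ : IsAngles b θ) (i : Fin 3) {y : ℝ} (hy₀ : 0 ≤ y) (hy₁ : y ≤ 1) :
    InnerProductGeometry.angle (b (i - 1) - b i) (chord b i y) ≤ θ i ∧
      detourRatio θ i (InnerProductGeometry.angle (b (i - 1) - b i) (chord b i y)) *
        ‖chord b i y‖ = sideLen b i + min (y * sideLen b i + sideLen b (i - 1))
          ((1 - y) * sideLen b i + sideLen b (i + 1)) := by
  obtain ⟨hij, hik, hjk⟩ := distinct_add_sub (m := 1) (Or.inl rfl) i
  have h := detour_expression (gram_pos b hij hik hjk) hy₀ hy₁ (Z := chord b i y) rfl rfl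
    (hθ i) (B := θ (i - 1)) (C := θ (i + 1)) ?_ ?_
  · have e : b (i + 1) - b i - (b (i - 1) - b i) = b (i + 1) - b (i - 1) := by abel
    rw [e, ← dist_eq_norm, ← dist_eq_norm, ← dist_eq_norm, ← sideLen_eq b hij hik hjk,
      ← sideLen_eq b hjk.symm hik.symm hij.symm, ← sideLen_eq b hjk hij.symm hik.symm] at h
    exact h
  · rw [hθ.eq_angle hik.symm hjk.symm hij]
    congr 1 <;> abel
  · rw [hθ.eq_angle (i := i + 1) (j := i - 1) (k := i) hjk hij.symm hik.symm]
    congr 1 <;> abel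

/-- As `y` runs over `[0, 1]` the angle moves continuously from `0` to `θ i`. -/
theorem exists_chord_angle_eq {b : AffineBasis (Fin 3) ℝ Plane} {θ : Fin 3 → ℝ}
    (hθ : IsAngles b θ) (i : Fin 3) {α : ℝ} (hα : α ∈ Set.Icc 0 (θ i)) :
    ∃ y ∈ Set.Icc (0 : ℝ) 1,
      InnerProductGeometry.angle (b (i - 1) - b i) (chord b i y) = α := by
  obtain ⟨hij, hik, hjk⟩ := distinct_add_sub (m := 1) (Or.inl rfl) i
  have hne : b (i - 1) - b i ≠ 0 := sub_ne_zero.2 (b.ind.injective.ne hik.symm)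
  have hcont : Continuous fun y => InnerProductGeometry.angle (b (i - 1) - b i)
      (chord b i y) := by
    refine continuous_iff_continuousAt.2 fun y => ?_
    have h1 := InnerProductGeometry.continuousAt_angle (x := (b (i - 1) - b i, chord b i y))
      hne (chord_ne_zero b i y)
    refine ContinuousAt.comp (f := fun y => (b (i - 1) - b i, chord b i y)) h1 ?_
    refine Continuous.continuousAt ?_
    unfold chord
    fun_prop
  have h := intermediate_value_Icc zero_le_one hcont.continuousOn
  have h0 : InnerProductGeometry.angle (b (i - 1) - b i) (chord b i 0) = 0 := by
    simp [chord, InnerProductGeometry.angle_self hne]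
  have h1 : InnerProductGeometry.angle (b (i - 1) - b i) (chord b i 1) = θ i := by
    rw [hθ.eq_angle hik hij hjk.symm]
    simp [chord]
  rw [h0, h1] at h
  obtain ⟨y, hy, hy'⟩ := h hα
  exact ⟨y, hy, hy'⟩

/-! ### Initial bounds in terms of the constant -/

section Constant

variable {b : AffineBasis (Fin 3) ℝ Plane} {θ₁ θ₂ : ℝ}

theorem le_routingConstant_mul_norm_chord (hθ : IsAngles b (angles θ₁ θ₂)) (h₁ : 0 < θ₁)
    (i : Fin 3) {y : ℝ} (hy₀ : 0 ≤ y) (hy₁ : y ≤ 1) :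
    sideLen b i + min (y * sideLen b i + sideLen b (i - 1))
      ((1 - y) * sideLen b i + sideLen b (i + 1)) ≤ routingConstant θ₁ θ₂ * ‖chord b i y‖ := by
  obtain ⟨h1, h2⟩ := detourRatio_mul_norm_chord hθ i hy₀ hy₁
  rw [← h2]
  exact mul_le_mul_of_nonneg_right ((isGreatest_routingConstant h₁).2
    ⟨i, _, ⟨InnerProductGeometry.angle_nonneg _ _, h1⟩, rfl⟩) (norm_nonneg _)

theorem Good.of_negCone (hθ : IsAngles b (angles θ₁ θ₂)) (h₁ : 0 < θ₁) {S : Set Plane}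
    {p t : Plane} (i : Fin 3) (hneg : ∀ l, l ≠ i → b.coord l t < b.coord l p) :
    Good b S t p (routingConstant θ₁ θ₂ * dist p t) := by
  obtain ⟨hij, hik, hjk⟩ := distinct_add_sub (m := 1) (Or.inl rfl) i
  have hj := hneg _ hij.symm
  have hk := hneg _ hik.symm
  have sp := coord_add_eq_one b hij hik hjk p
  have st := coord_add_eq_one b hij hik hjk t
  set r := b.coord i t - b.coord i p with hr
  have hr0 : 0 < r := by linarith
  -- `T^{p,t}` has size `r`, and `p` divides its side opposite to `t` in the ratio `y : 1 - y`.
  set y := (b.coord (i + 1) p - b.coord (i + 1) t) / r with hy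
  have hyr : y * r = b.coord (i + 1) p - b.coord (i + 1) t := by
    rw [hy, div_mul_cancel₀ _ hr0.ne']
  have hyr' : (1 - y) * r = b.coord (i - 1) p - b.coord (i - 1) t := by
    rw [sub_mul, hyr, hr]
    linarith
  have hy₀ : 0 ≤ y := div_nonneg (by linarith) hr0.le
  have hy₁ : y ≤ 1 := (div_le_one hr0).2 (by linarith)
  have hd : dist p t = r * ‖chord b i y‖ := by
    have : p - t = r • chord b i y := by
      rw [sub_eq_smul_add_smul b hjk hij.symm hik.symm t p, ← hyr, ← hyr', chord]
      module
    rw [dist_eq_norm, this, norm_smul, Real.norm_eq_abs, abs_of_pos hr0]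
  have h := mul_le_mul_of_nonneg_left
    (le_routingConstant_mul_norm_chord hθ h₁ i hy₀ hy₁) hr0.le
  have hd' : r * (routingConstant θ₁ θ₂ * ‖chord b i y‖) =
      routingConstant θ₁ θ₂ * dist p t := by
    rw [hd]
    ring
  rw [hd'] at h
  rcases le_total (y * sideLen b i + sideLen b (i - 1))
    ((1 - y) * sideLen b i + sideLen b (i + 1)) with h' | h'
  · rw [min_eq_left h'] at h
    refine Good.any i (i - 1) (i + 1) hik hij hjk.symm hk hj ?_
    rw [← hyr]
    linarith
  · rw [min_eq_right h'] at h
    refine Good.any i (i + 1) (i - 1) hij hik hjk hj hk ?_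
    rw [← hyr']
    linarith

/-- Two sides of a triangle against the third: with a fixed angle and a fixed sum of the legs, the
base is shortest in the isosceles case. -/
theorem norm_add_norm_mul_sin_le {V : Type*} [NormedAddCommGroup V] [InnerProductSpace ℝ V]
    (x y : V) :
    (‖x‖ + ‖y‖) * Real.sin (InnerProductGeometry.angle x y / 2) ≤ ‖x - y‖ := by
  set φ := InnerProductGeometry.angle x y with hφ
  have h1 := InnerProductGeometry.norm_sub_sq_eq_norm_sq_add_norm_sq_sub_two_mul_norm_mul_norm_mul_cos_angle x y
  rw [← hφ] at h1
  have h2 : Real.cos φ = 1 - 2 * Real.sin (φ / 2) ^ 2 := by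
    have := Real.cos_two_mul (φ / 2)
    rw [mul_div_cancel₀ φ two_ne_zero] at this
    rw [this, Real.cos_sq']
    ring
  rw [h2] at h1
  refine le_of_sq_le_sq ?_ (norm_nonneg _)
  have h3 : 0 ≤ (1 - Real.sin (φ / 2) ^ 2) * (‖x‖ - ‖y‖) ^ 2 :=
    mul_nonneg (by linarith [Real.sin_sq_le_one (φ / 2)]) (sq_nonneg _)
  nlinarith

theorem angles_pos_lt_pi (hθ : IsAngles b (angles θ₁ θ₂)) (i : Fin 3) :
    0 < angles θ₁ θ₂ i ∧ angles θ₁ θ₂ i < Real.pi := by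
  obtain ⟨hij, hik, hjk⟩ := distinct_add_sub (m := 1) (Or.inl rfl) i
  have h := gram_pos b hij hik hjk
  have h1 := InnerProductGeometry.sin_angle_mul_norm_mul_norm (b (i + 1) - b i)
    (b (i - 1) - b i)
  have h2 := Real.sqrt_pos.2 h
  rw [← h1, ← hθ i] at h2
  have h0 : 0 ≤ angles θ₁ θ₂ i := by
    rw [hθ i]
    exact InnerProductGeometry.angle_nonneg _ _
  have hpi : angles θ₁ θ₂ i ≤ Real.pi := by
    rw [hθ i]
    exact InnerProductGeometry.angle_le_pi _ _
  constructor
  · refine lt_of_le_of_ne h0 fun h => ?_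
    rw [← h, Real.sin_zero, zero_mul] at h2
    exact lt_irrefl _ h2
  · refine lt_of_le_of_ne hpi fun h => ?_
    rw [h, Real.sin_pi, zero_mul] at h2
    exact lt_irrefl _ h2

/-- In the triangle of `p`, the corner `j` of `T^{p,t}` and `t`, the angle at the corner is `θ_j ≥
θ₁`. -/
theorem Good.of_posCone (hθ : IsAngles b (angles θ₁ θ₂)) (h₁₂ : θ₁ ≤ θ₂)
    (h₂₃ : θ₂ ≤ Real.pi - θ₁ - θ₂) {S : Set Plane}
    {p t : Plane} (i : Fin 3) (hpos : ∀ l, l ≠ i → b.coord l p < b.coord l t) :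
    Good b S t p (1 / Real.sin (θ₁ / 2) * dist p t) := by
  have hθ₁ := angles_pos_lt_pi hθ 0
  change 0 < θ₁ ∧ θ₁ < Real.pi at hθ₁
  have hmin : ∀ l, θ₁ ≤ angles θ₁ θ₂ l := by
    intro l
    fin_cases l
    · exact le_rfl
    · exact h₁₂
    · exact h₁₂.trans h₂₃
  have hs : 0 < Real.sin (θ₁ / 2) := Real.sin_pos_of_pos_of_lt_pi (by linarith) (by linarith)
  have key : ∀ j k : Fin 3, i ≠ j → i ≠ k → j ≠ k →
      (b.coord i p - b.coord i t) * sideLen b k + (b.coord k t - b.coord k p) * sideLen b i ≤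
        1 / Real.sin (θ₁ / 2) * dist p t := by
    intro j k hij hik hjk
    have hj := hpos _ hij.symm
    have hk := hpos _ hik.symm
    have sp := coord_add_eq_one b hij hik hjk p
    have st := coord_add_eq_one b hij hik hjk t
    have hi : 0 < b.coord i p - b.coord i t := by linarith
    have h1 := norm_add_norm_mul_sin_le ((b.coord i p - b.coord i t) • (b i - b j))
      ((b.coord k t - b.coord k p) • (b k - b j))
    rw [InnerProductGeometry.angle_smul_left_of_pos _ _ hi,
      InnerProductGeometry.angle_smul_right_of_pos _ _ (sub_pos.2 hk),
      ← hθ.eq_angle hij.symm hjk hik, norm_smul, norm_smul, Real.norm_eq_abs, Real.norm_eq_abs,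
      abs_of_pos hi, abs_of_pos (sub_pos.2 hk), ← dist_eq_norm, ← dist_eq_norm,
      ← sideLen_eq b hik.symm hjk.symm hij, ← sideLen_eq b hik hij hjk.symm] at h1
    have h2 : (b.coord i p - b.coord i t) • (b i - b j) -
        (b.coord k t - b.coord k p) • (b k - b j) = p - t := by
      rw [sub_eq_smul_add_smul b hik hij hjk.symm t p]
      module
    rw [h2, ← dist_eq_norm] at h1
    have h3 : Real.sin (θ₁ / 2) ≤ Real.sin (angles θ₁ θ₂ j / 2) := by
      have := hmin j
      have := (angles_pos_lt_pi hθ j).2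
      exact Real.sin_le_sin_of_le_of_le_pi_div_two (by linarith) (by linarith) (by linarith)
    rw [one_div, ← div_eq_inv_mul, le_div_iff₀ hs]
    refine (mul_le_mul_of_nonneg_left h3 ?_).trans h1
    exact add_nonneg (mul_nonneg hi.le (sideLen_pos b k).le)
      (mul_nonneg (sub_pos.2 hk).le (sideLen_pos b i).le)
  obtain ⟨hij, hik, hjk⟩ := distinct_add_sub (m := 1) (Or.inl rfl) i
  exact Good.pos i _ _ hij hik hjk (hpos _ hij.symm) (hpos _ hik.symm) (key _ _ hij hik hjk)
    (key _ _ hik hij hjk.symm)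

/-- An isosceles triangle with apex angle `θ₁` at the corner 0 and legs `sideLen b 1` has base `2 *
sideLen b 1 * sin (θ₁ / 2)`. It fits along the side from corner 0 to corner 1 because `θ₂ ≤ θ₃`
makes that side at least as long, and for its base as chord the three-sided walk is at least two
legs. -/
theorem one_div_sin_le_routingConstant (hθ : IsAngles b (angles θ₁ θ₂))
    (h₂₃ : θ₂ ≤ Real.pi - θ₁ - θ₂) :
    1 / Real.sin (θ₁ / 2) ≤ routingConstant θ₁ θ₂ := by
  have hθ₁ := angles_pos_lt_pi hθ 0
  change 0 < θ₁ ∧ θ₁ < Real.pi at hθ₁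
  have hs : 0 < Real.sin (θ₁ / 2) := Real.sin_pos_of_pos_of_lt_pi (by linarith) (by linarith)
  have l0 := sideLen_pos b 0
  have l1 := sideLen_pos b 1
  have l2 := sideLen_pos b 2
  have hle : sideLen b 1 ≤ sideLen b 2 := by
    have hcol : ¬ Collinear ℝ ({b 0, b 2, b 1} : Set Plane) := by
      have := affineIndependent_iff_not_collinear.1 b.ind
      convert! this using 2
      ext z
      simp [Fin.exists_fin_succ, eq_comm]
      tauto
    have h := (EuclideanGeometry.angle_le_iff_dist_le hcol).1 ?_
    · rwa [← sideLen_eq b (by decide : (1 : Fin 3) ≠ 0) (by decide) (by decide),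
        ← sideLen_eq b (by decide : (2 : Fin 3) ≠ 0) (by decide) (by decide)] at h
    · have e1 := hθ.eq_angle (by decide : (1 : Fin 3) ≠ 0) (by decide : (1 : Fin 3) ≠ 2)
        (by decide)
      have e2 := hθ.eq_angle (by decide : (2 : Fin 3) ≠ 0) (by decide : (2 : Fin 3) ≠ 1)
        (by decide)
      change InnerProductGeometry.angle (b 0 - b 1) (b 2 - b 1) ≤
        InnerProductGeometry.angle (b 0 - b 2) (b 1 - b 2)
      rw [← e1, ← e2]
      exact h₂₃
  -- The chord from the corner 2 that ends at distance `sideLen b 1` from the corner 0.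
  set y := 1 - sideLen b 1 / sideLen b 2 with hy
  have hy' : (1 - y) * sideLen b 2 = sideLen b 1 := by
    rw [hy, sub_sub_cancel, div_mul_cancel₀ _ l2.ne']
  have hq₁ : sideLen b 1 / sideLen b 2 ≤ 1 := (div_le_one l2).2 hle
  have hq₀ : 0 < sideLen b 1 / sideLen b 2 := div_pos l1 l2
  have h := le_routingConstant_mul_norm_chord hθ hθ₁.1 2 (y := y) (by linarith) (by linarith)
  have hc : chord b 2 y = (1 - y) • (b 1 - b 0) - (b 2 - b 0) := by
    change (1 - y) • (b 1 - b 2) + y • (b 0 - b 2) = _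
    module
  have hn : ‖chord b 2 y‖ = 2 * sideLen b 1 * Real.sin (θ₁ / 2) := by
    rw [← sq_eq_sq₀ (norm_nonneg _) (by positivity), hc, sq,
      InnerProductGeometry.norm_sub_sq_eq_norm_sq_add_norm_sq_sub_two_mul_norm_mul_norm_mul_cos_angle,
      InnerProductGeometry.angle_smul_left_of_pos _ _ (by linarith : 0 < 1 - y),
      ← hθ.eq_angle (by decide : (0 : Fin 3) ≠ 1) (by decide : (0 : Fin 3) ≠ 2) (by decide),
      norm_smul, Real.norm_eq_abs, abs_of_pos (by linarith : 0 < 1 - y), ← dist_eq_norm,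
      ← dist_eq_norm, ← sideLen_eq b (by decide : (2 : Fin 3) ≠ 1) (by decide) (by decide),
      ← sideLen_eq b (by decide : (1 : Fin 3) ≠ 2) (by decide) (by decide), hy']
    change _ - _ * Real.cos θ₁ = _
    have := Real.cos_two_mul (θ₁ / 2)
    rw [mul_div_cancel₀ θ₁ two_ne_zero] at this
    rw [this, Real.cos_sq']
    ring
  have hmin : sideLen b 1 * 2 ≤ sideLen b 2 + min (y * sideLen b 2 + sideLen b (2 - 1))
      ((1 - y) * sideLen b 2 + sideLen b (2 + 1)) := by
    rw [← sub_le_iff_le_add', hy']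
    change _ ≤ min (_ + sideLen b 1) (_ + sideLen b 0)
    have : 0 ≤ y * sideLen b 2 := mul_nonneg (by linarith) l2.le
    exact le_min (by linarith) (by linarith)
  have h2 := hmin.trans h
  rw [hn] at h2
  rw [div_le_iff₀ hs]
  nlinarith

end Constant

/-! ### The first move of a local algorithm -/

/-- An algorithm may stay at `s` and only change its register. Its states still agree in both
graphs, up to and including the first departure, since they depend on the same neighbourhood. -/
theorem RoutingAlgorithm.state_eq_of_nbhd_eq {M : Type*} (A : RoutingAlgorithm M)
    {G G' : SimpleGraph Plane} {k : ℕ} {s t : Plane} (hN : nbhd G k s = nbhd G' k s) {m : ℕ}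
    (h : ∀ m' ≤ m, (A.state G k s t m').1 = s) :
    ∀ m' ≤ m + 1, A.state G' k s t m' = A.state G k s t m' := by
  intro m'
  induction m' with
  | zero => exact fun _ => rfl
  | succ m' ih =>
    intro hm
    rw [RoutingAlgorithm.state, RoutingAlgorithm.state, ih (by omega), h m' (by omega), hN]

/-- Cut the path at the first departure from `s` and just before the first arrival at `t`, where it
must be at `e`; then use the triangle inequality on the pieces. -/
theorem RoutingAlgorithm.RoutesWithin.exists_first_move {M : Type*} {A : RoutingAlgorithm M}
    {G : SimpleGraph Plane} {k : ℕ} {s t e : Plane} {L : ℝ} (h : A.RoutesWithin G k s t L)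
    (hst : s ≠ t) (hse : s ≠ e) (he : ∀ z, G.Adj z t → z = e) :
    ∃ m, (∀ m' ≤ m, (A.state G k s t m').1 = s) ∧ G.Adj s (A.state G k s t (m + 1)).1 ∧
      dist s (A.state G k s t (m + 1)).1 + dist (A.state G k s t (m + 1)).1 e + dist e t ≤ L := by
  classical
  obtain ⟨N, hN, hstep, hL⟩ := h
  set x : ℕ → Plane := fun n => (A.state G k s t n).1 with hx
  have hadj : ∀ n < N, x (n + 1) ≠ x n → G.Adj (x n) (x (n + 1)) := fun n hn hne =>
    ((mem_nbhd_one_iff _ _ _).1 (hstep n hn)).resolve_left hne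
  have hx0 : x 0 = s := rfl
  have hleave : ∃ n, x n ≠ s := ⟨N, fun h => hst (h.symm.trans hN)⟩
  have harrive : ∃ n, x n = t := ⟨N, hN⟩
  obtain ⟨f, hf⟩ : ∃ f, Nat.find hleave = f + 1 :=
    Nat.exists_eq_succ_of_ne_zero fun h => Nat.find_spec hleave (h ▸ hx0)
  obtain ⟨g, hg⟩ : ∃ g, Nat.find harrive = g + 1 :=
    Nat.exists_eq_succ_of_ne_zero fun h => hst (hx0 ▸ (h ▸ Nat.find_spec harrive : x 0 = t))
  have hf1 : ∀ m ≤ f, x m = s := fun m hm => by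
    have := Nat.find_min hleave (m := m) (by omega)
    exact not_not.1 this
  have hf2 : x (f + 1) ≠ s := hf ▸ Nat.find_spec hleave
  have hg1 : x g ≠ t := Nat.find_min harrive (by omega)
  have hg2 : x (g + 1) = t := hg ▸ Nat.find_spec harrive
  have hgN : g + 1 ≤ N := hg ▸ Nat.find_min' harrive hN
  have hge : x g = e := by
    refine he _ ?_
    have := hadj g (by omega) (by rw [hg2]; exact hg1.symm)
    rwa [hg2] at this
  have hfg : f + 1 ≤ g := by
    by_contra! hlt
    exact hse ((hf1 g (by omega)).symm.trans hge)
  refine ⟨f, hf1, ?_, ?_⟩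
  · have := hadj f (by omega) (by rw [hf1 f le_rfl]; exact hf2)
    rwa [hf1 f le_rfl] at this
  · have d1 := dist_le_Ico_sum_dist x (Nat.zero_le (f + 1))
    have d2 := dist_le_Ico_sum_dist x hfg
    have d3 := dist_le_Ico_sum_dist x (Nat.le_succ g)
    rw [hge] at d2 d3
    rw [Nat.succ_eq_add_one, hg2] at d3
    rw [hx0] at d1
    refine le_trans ?_ hL
    calc _ ≤ _ := add_le_add (add_le_add d1 d2) d3
      _ = ∑ n ∈ Finset.Ico 0 (g + 1), dist (x n) (x (n + 1)) := by
        rw [Finset.sum_Ico_consecutive _ (Nat.zero_le _) hfg,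
          Finset.sum_Ico_consecutive _ (Nat.zero_le _) (Nat.le_succ g)]
      _ ≤ _ := by
        rw [← Finset.range_eq_Ico]
        exact Finset.sum_le_sum_of_subset_of_nonneg (Finset.range_subset_range.2 hgN)
          fun _ _ _ => dist_nonneg

/-- Two graphs that look the same from `s` lead to the same first move. -/
theorem RoutingAlgorithm.exists_common_first_move {M : Type*} {A : RoutingAlgorithm M}
    {G G' : SimpleGraph Plane} {k : ℕ} {s t e e' : Plane} {L : ℝ}
    (hN : nbhd G k s = nbhd G' k s) (h : A.RoutesWithin G k s t L)
    (h' : A.RoutesWithin G' k s t L) (hst : s ≠ t) (hse : s ≠ e) (hse' : s ≠ e')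
    (he : ∀ z, G.Adj z t → z = e) (he' : ∀ z, G'.Adj z t → z = e') :
    ∃ v, G.Adj s v ∧ dist s v + dist v e + dist e t ≤ L ∧
      dist s v + dist v e' + dist e' t ≤ L := by
  obtain ⟨m, hm, hadj, hL⟩ := h.exists_first_move hst hse he
  obtain ⟨m', hm', hadj', hL'⟩ := h'.exists_first_move hst hse' he'
  have e1 := A.state_eq_of_nbhd_eq hN hm
  have e2 := A.state_eq_of_nbhd_eq hN.symm hm'
  -- Were one departure earlier, the shared state would be both at `s` and adjacent to `s`.
  have hmm : m = m' := by
    rcases lt_trichotomy m m' with hlt | heq | hlt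
    · rw [← e1 _ le_rfl, hm' _ (by omega)] at hadj
      exact absurd hadj (G.loopless.irrefl s)
    · exact heq
    · rw [← e2 _ le_rfl, hm _ (by omega)] at hadj'
      exact absurd hadj' (G'.loopless.irrefl s)
  subst hmm
  rw [e1 _ le_rfl] at hL'
  exact ⟨_, hadj, hL, hL'⟩

/-! ### Zigzag chains -/

/-- The points `c 0, …, c n` climb towards `t`, alternating between two sides: those with an odd
index have large coordinates `j`, increasing, and those with an even index have large
coordinates `k`, increasing. -/
structure Zigzag (b : AffineBasis (Fin 3) ℝ Plane) (i j k : Fin 3) (t : Plane) (n : ℕ)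
    (c : ℕ → Plane) : Prop where
  left_pos : ∀ l ≤ n, b.coord j t < b.coord j (c l)
  right_pos : ∀ l ≤ n, b.coord k t < b.coord k (c l)
  height : ∀ l l', l < l' → l' ≤ n → b.coord i (c l) < b.coord i (c l')
  even_left : ∀ l l', l < l' → l' ≤ n → Even l → Even l' → b.coord j (c l') < b.coord j (c l)
  even_right : ∀ l l', l < l' → l' ≤ n → Even l → Even l' → b.coord k (c l) < b.coord k (c l')
  odd_left : ∀ l l', l < l' → l' ≤ n → Odd l → Odd l' → b.coord j (c l) < b.coord j (c l')
  odd_right : ∀ l l', l < l' → l' ≤ n → Odd l → Odd l' → b.coord k (c l') < b.coord k (c l)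
  cross_left : ∀ l l', l ≤ n → l' ≤ n → Even l → Odd l' → b.coord j (c l) < b.coord j (c l')
  cross_right : ∀ l l', l ≤ n → l' ≤ n → Even l → Odd l' → b.coord k (c l') < b.coord k (c l)

/-- The points of a chain and the destination. -/
def chainSet (c : ℕ → Plane) (n : ℕ) (t : Plane) : Set Plane := insert t (c '' Set.Iic n)

theorem mem_chainSet {c : ℕ → Plane} {n : ℕ} {t z : Plane} :
    z ∈ chainSet c n t ↔ z = t ∨ ∃ l ≤ n, c l = z := Iff.rfl

theorem chain_mem_chainSet {c : ℕ → Plane} {n l : ℕ} (t : Plane) (hl : l ≤ n) :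
    c l ∈ chainSet c n t := Or.inr ⟨l, hl, rfl⟩

theorem finite_chainSet (c : ℕ → Plane) (n : ℕ) (t : Plane) : (chainSet c n t).Finite :=
  ((Set.finite_Iic n).image c).insert t

namespace Zigzag

variable {b : AffineBasis (Fin 3) ℝ Plane} {i j k : Fin 3} {t : Plane} {n : ℕ} {c : ℕ → Plane}

theorem mono (hz : Zigzag b i j k t n c) {m : ℕ} (hm : m ≤ n) : Zigzag b i j k t m c where
  left_pos l hl := hz.left_pos l (hl.trans hm)
  right_pos l hl := hz.right_pos l (hl.trans hm)
  height l l' h hl := hz.height l l' h (hl.trans hm)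
  even_left l l' h hl := hz.even_left l l' h (hl.trans hm)
  even_right l l' h hl := hz.even_right l l' h (hl.trans hm)
  odd_left l l' h hl := hz.odd_left l l' h (hl.trans hm)
  odd_right l l' h hl := hz.odd_right l l' h (hl.trans hm)
  cross_left l l' h hl := hz.cross_left l l' (h.trans hm) (hl.trans hm)
  cross_right l l' h hl := hz.cross_right l l' (h.trans hm) (hl.trans hm)

theorem left_ne (hz : Zigzag b i j k t n c) {l l' : ℕ} (h : l < l') (hl : l' ≤ n) :
    b.coord j (c l) ≠ b.coord j (c l') := by
  rcases Nat.even_or_odd l with h1 | h1 <;> rcases Nat.even_or_odd l' with h2 | h2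
  · exact (hz.even_left l l' h hl h1 h2).ne'
  · exact (hz.cross_left l l' (by omega) hl h1 h2).ne
  · exact (hz.cross_left l' l hl (by omega) h2 h1).ne'
  · exact (hz.odd_left l l' h hl h1 h2).ne

theorem right_ne (hz : Zigzag b i j k t n c) {l l' : ℕ} (h : l < l') (hl : l' ≤ n) :
    b.coord k (c l) ≠ b.coord k (c l') := by
  rcases Nat.even_or_odd l with h1 | h1 <;> rcases Nat.even_or_odd l' with h2 | h2
  · exact (hz.even_right l l' h hl h1 h2).ne
  · exact (hz.cross_right l l' (by omega) hl h1 h2).ne'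
  · exact (hz.cross_right l' l hl (by omega) h2 h1).ne
  · exact (hz.odd_right l l' h hl h1 h2).ne'

theorem height_lt (hz : Zigzag b i j k t n c) (hij : i ≠ j) (hik : i ≠ k) (hjk : j ≠ k) {l : ℕ}
    (hl : l ≤ n) : b.coord i (c l) < b.coord i t := by
  have h1 := coord_add_eq_one b hij hik hjk t
  have h2 := coord_add_eq_one b hij hik hjk (c l)
  linarith [hz.left_pos l hl, hz.right_pos l hl]

theorem ne_dest (hz : Zigzag b i j k t n c) {l : ℕ} (hl : l ≤ n) : c l ≠ t := fun h => by
  have := hz.left_pos l hl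
  rw [h] at this
  exact lt_irrefl _ this

theorem generalPosition (hz : Zigzag b i j k t n c) (hij : i ≠ j) (hik : i ≠ k) (hjk : j ≠ k) :
    GeneralPosition b (chainSet c n t) := by
  rw [generalPosition_iff]
  have hchain : ∀ l l', l < l' → l' ≤ n → ∀ m, b.coord m (c l) ≠ b.coord m (c l') := by
    intro l l' h hl
    rw [forall_iff_of_distinct hij hik hjk]
    exact ⟨(hz.height l l' h hl).ne, hz.left_ne h hl, hz.right_ne h hl⟩
  have hdest : ∀ l ≤ n, ∀ m, b.coord m (c l) ≠ b.coord m t := by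
    intro l hl
    rw [forall_iff_of_distinct hij hik hjk]
    exact ⟨(hz.height_lt hij hik hjk hl).ne, (hz.left_pos l hl).ne', (hz.right_pos l hl).ne'⟩
  rintro u hu v hv hne
  rcases mem_chainSet.1 hu with rfl | ⟨l, hl, rfl⟩ <;>
    rcases mem_chainSet.1 hv with rfl | ⟨l', hl', rfl⟩
  · exact absurd rfl hne
  · exact fun m => (hdest l' hl' m).symm
  · exact hdest l hl
  · rcases lt_trichotomy l l' with h | rfl | h
    · exact hchain l l' h hl'
    · exact absurd rfl hne
    · exact fun m => (hchain l' l h hl m).symm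

/-- The point with index `l' - 2` is on the side of `c l'` but farther out, and higher than `c l`,
hence inside their triangle. -/
theorem le_add_two_of_adj (hz : Zigzag b i j k t n c) (hij : i ≠ j) (hik : i ≠ k) (hjk : j ≠ k)
    {l l' : ℕ} (hl : l < l') (hl' : l' ≤ n)
    (h : (tdGraph b (chainSet c n t)).Adj (c l) (c l')) : l' ≤ l + 2 := by
  by_contra! hlt
  obtain ⟨m, rfl⟩ : ∃ m, l' = m + 2 := ⟨l' - 2, by omega⟩
  obtain ⟨d, hd⟩ := ((tdGraph_adj_iff _ _ _ _).1 h).2.2.2 (c m)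
    (chain_mem_chainSet t (by omega))
  have hlm : l < m := by omega
  rcases eq_or_eq_or_eq hij hik hjk d with rfl | rfl | rfl
  · exact absurd (hd.trans (min_le_left _ _)) (not_le.2 (hz.height l m hlm (by omega)))
  · rcases Nat.even_or_odd m with hm | hm
    · have hm2 : Even (m + 2) := by grind
      exact absurd (hd.trans (min_le_right _ _))
        (not_le.2 (hz.even_left m (m + 2) (by omega) hl' hm hm2))
    · refine absurd (hd.trans (min_le_left _ _)) (not_le.2 ?_)
      rcases Nat.even_or_odd l with hl | hl
      · exact hz.cross_left l m (by omega) (by omega) hl hm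
      · exact hz.odd_left l m hlm (by omega) hl hm
  · rcases Nat.even_or_odd m with hm | hm
    · refine absurd (hd.trans (min_le_left _ _)) (not_le.2 ?_)
      rcases Nat.even_or_odd l with hl | hl
      · exact hz.even_right l m hlm (by omega) hl hm
      · exact hz.cross_right m l (by omega) (by omega) hm hl
    · have hm2 : Odd (m + 2) := by grind
      exact absurd (hd.trans (min_le_right _ _))
        (not_le.2 (hz.odd_right m (m + 2) (by omega) hl' hm hm2))

/-- The highest point `c n` lies inside the triangle of `t` and any lower point. -/
theorem eq_last_of_adj (hz : Zigzag b i j k t n c) (hij : i ≠ j) (hik : i ≠ k) (hjk : j ≠ k)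
    (z : Plane) (h : (tdGraph b (chainSet c n t)).Adj z t) : z = c n := by
  rcases mem_chainSet.1 h.2.1 with rfl | ⟨l, hl, rfl⟩
  · exact absurd rfl h.1
  by_contra hne
  have hln : l < n := lt_of_le_of_ne hl fun h => hne (h ▸ rfl)
  obtain ⟨d, hd⟩ := ((tdGraph_adj_iff _ _ _ _).1 h).2.2.2 (c n) (chain_mem_chainSet t le_rfl)
  rcases eq_or_eq_or_eq hij hik hjk d with rfl | rfl | rfl
  · exact absurd (hd.trans (min_le_left _ _)) (not_le.2 (hz.height l n hln le_rfl))
  · exact absurd (hd.trans (min_le_right _ _)) (not_le.2 (hz.left_pos n le_rfl))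
  · exact absurd (hd.trans (min_le_right _ _)) (not_le.2 (hz.right_pos n le_rfl))

/-- A point `c m` with `m ≤ l` is excluded by its height. A later one is excluded by the coordinate
in which its side is small: `j` for even `m`, `k` for odd `m`. -/
theorem adj_of_le_add_two (hz : Zigzag b i j k t n c) {l l' : ℕ} (hl : l < l') (hl' : l' ≤ n)
    (h : l' ≤ l + 2) : (tdGraph b (chainSet c n t)).Adj (c l) (c l') := by
  rw [tdGraph_adj_iff]
  refine ⟨fun he => hz.left_ne hl hl' (he ▸ rfl), chain_mem_chainSet t (by omega),
    chain_mem_chainSet t hl', fun z hzS => ?_⟩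
  rcases mem_chainSet.1 hzS with rfl | ⟨m, hm, rfl⟩
  · exact ⟨j, le_min (hz.left_pos l (by omega)).le (hz.left_pos l' hl').le⟩
  rcases le_or_gt m l with hml | hml
  · refine ⟨i, ?_⟩
    rcases hml.eq_or_lt with rfl | hml
    · exact le_min le_rfl (hz.height m l' hl hl').le
    · exact le_min (hz.height m l hml (by omega)).le (hz.height m l' (by omega) hl').le
  have hE : ∀ a, a ≤ n → Even m → a ≤ m → b.coord j (c m) ≤ b.coord j (c a) := by
    intro a ha hme ham
    rcases ham.eq_or_lt with rfl | ham
    · exact le_rfl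
    rcases Nat.even_or_odd a with h1 | h1
    · exact (hz.even_left a m ham hm h1 hme).le
    · exact (hz.cross_left m a hm ha hme h1).le
  have hO : ∀ a, a ≤ n → Odd m → a ≤ m → b.coord k (c m) ≤ b.coord k (c a) := by
    intro a ha hmo ham
    rcases ham.eq_or_lt with rfl | ham
    · exact le_rfl
    rcases Nat.even_or_odd a with h1 | h1
    · exact (hz.cross_right a m ha hm h1 hmo).le
    · exact (hz.odd_right a m ham hm h1 hmo).le
  rcases le_or_gt l' m with hlm | hlm
  · rcases Nat.even_or_odd m with hm' | hm'
    · exact ⟨j, le_min (hE l (by omega) hm' hml.le) (hE l' hl' hm' hlm)⟩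
    · exact ⟨k, le_min (hO l (by omega) hm' hml.le) (hO l' hl' hm' hlm)⟩
  · obtain rfl : m = l + 1 := by omega
    obtain rfl : l' = l + 2 := by omega
    rcases Nat.even_or_odd (l + 1) with hm' | hm'
    · exact ⟨j, le_min (hE l (by omega) hm' hml.le)
        (hz.cross_left (l + 1) (l + 2) hm hl' hm' (by grind)).le⟩
    · exact ⟨k, le_min (hO l (by omega) hm' hml.le)
        (hz.cross_right (l + 2) (l + 1) hl' hm (by grind) hm').le⟩

/-- Every edge climbs by at most two indices, so a short walk never reaches `c n`, the only gate to
`t`. -/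
theorem exists_of_walk (hz : Zigzag b i j k t n c) (hij : i ≠ j) (hik : i ≠ k) (hjk : j ≠ k)
    {u v : Plane} (w : (tdGraph b (chainSet c n t)).Walk u v) {l : ℕ} (hu : u = c l)
    (hl : l + 2 * w.length < n) : ∃ l' ≤ l + 2 * w.length, v = c l' := by
  induction w generalizing l with
  | nil => exact ⟨l, by omega, hu⟩
  | @cons u x v h q ih =>
    rw [SimpleGraph.Walk.length_cons] at hl ⊢
    subst hu
    rcases mem_chainSet.1 h.2.2.1 with rfl | ⟨l', hl', rfl⟩
    · have h1 := hz.eq_last_of_adj hij hik hjk _ h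
      exact absurd (h1 ▸ rfl) (hz.left_ne (l := l) (l' := n) (by omega) le_rfl)
    · have hle : l' ≤ l + 2 := by
        rcases lt_or_ge l l' with h1 | h1
        · exact hz.le_add_two_of_adj hij hik hjk h1 hl' h
        · omega
      obtain ⟨l'', h1, h2⟩ := ih rfl (by omega)
      exact ⟨l'', by omega, h2⟩

theorem exists_walk (hz : Zigzag b i j k t n c) (m : ℕ) :
    ∀ l ≤ 2 * m, l ≤ n → ∃ w : (tdGraph b (chainSet c n t)).Walk (c 0) (c l), w.length ≤ m := by
  induction m with
  | zero =>
    intro l hl _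
    obtain rfl : l = 0 := by omega
    exact ⟨SimpleGraph.Walk.nil, le_rfl⟩
  | succ m ih =>
    intro l hl hln
    rcases le_or_gt l (2 * m) with h | h
    · obtain ⟨w, hw⟩ := ih l h hln
      exact ⟨w, by omega⟩
    · obtain ⟨w, hw⟩ := ih (l - 2) (by omega) (by omega)
      refine ⟨w.concat (hz.adj_of_le_add_two (by omega) hln (by omega)), ?_⟩
      rw [SimpleGraph.Walk.length_concat]
      omega

/-- The right side does not depend on `n`: chains with different ends cannot be told apart from `c
0`. -/
theorem nbhd_eq (hz : Zigzag b i j k t n c) (hij : i ≠ j) (hik : i ≠ k) (hjk : j ≠ k) {m : ℕ}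
    (hm : 2 * m < n) : nbhd (tdGraph b (chainSet c n t)) m (c 0) = c '' Set.Iic (2 * m) := by
  ext v
  constructor
  · rintro ⟨w, hw⟩
    obtain ⟨l, hl, rfl⟩ := hz.exists_of_walk hij hik hjk w rfl (by omega)
    exact ⟨l, Set.mem_Iic.2 (by omega), rfl⟩
  · rintro ⟨l, hl, rfl⟩
    rw [Set.mem_Iic] at hl
    exact hz.exists_walk m l hl (by omega)

/-- A competitive local algorithm has to visit both ends of the side opposite to `t`. -/
theorem le_of_isCompetitive {m : ℕ} (hz : Zigzag b i j k t (2 * m + 4) c) (hij : i ≠ j)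
    (hik : i ≠ k) (hjk : j ≠ k) {M : Type*} {A : RoutingAlgorithm M} {L : ℝ}
    (hA : A.IsCompetitive b m L) :
    dist (c 0) (c 1) + dist (c 1) (c (2 * m + 4)) + dist (c (2 * m + 4)) t ≤ L * dist (c 0) t ∨
    dist (c 0) (c 2) + dist (c 2) (c (2 * m + 3)) + dist (c (2 * m + 3)) t ≤
      L * dist (c 0) t := by
  -- Both lengths exceed `2 * m`, so the `m`-neighbourhoods of the start agree, while the last
  -- indices have different parity and so are near different corners.
  have hz' : Zigzag b i j k t (2 * m + 3) c := hz.mono (by omega)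
  have h := hA _ (finite_chainSet c (2 * m + 4) t) (hz.generalPosition hij hik hjk) _
    (chain_mem_chainSet t (Nat.zero_le _)) t (Or.inl rfl)
  have h' := hA _ (finite_chainSet c (2 * m + 3) t) (hz'.generalPosition hij hik hjk) _
    (chain_mem_chainSet t (Nat.zero_le _)) t (Or.inl rfl)
  have hne : ∀ l, 0 < l → l ≤ 2 * m + 4 → c 0 ≠ c l := fun l h1 h2 he =>
    hz.left_ne h1 h2 (he ▸ rfl)
  obtain ⟨v, hadj, h1, h2⟩ := RoutingAlgorithm.exists_common_first_move
    (by rw [hz.nbhd_eq hij hik hjk (by omega), hz'.nbhd_eq hij hik hjk (by omega)])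
    h h' (hz.ne_dest (Nat.zero_le _)) (hne _ (by omega) (by omega))
    (hne _ (by omega) (by omega)) (hz.eq_last_of_adj hij hik hjk)
    (hz'.eq_last_of_adj hij hik hjk)
  rcases mem_chainSet.1 hadj.2.2.1 with rfl | ⟨l, hl, rfl⟩
  · exact absurd (hz.eq_last_of_adj hij hik hjk _ hadj) (hne _ (by omega) le_rfl)
  · have hl0 : l ≠ 0 := by
      rintro rfl
      exact hadj.1 rfl
    have hl2 := hz.le_add_two_of_adj hij hik hjk (Nat.pos_of_ne_zero hl0) hl hadj
    rcases (by omega : l = 1 ∨ l = 2) with rfl | rfl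
    · exact Or.inl h1
    · exact Or.inr h2

end Zigzag

/-! ### A concrete chain near two corners -/

/-- The point with coordinates `h` and `u` with respect to `b i` and `b j`. -/
noncomputable def baryPoint (b : AffineBasis (Fin 3) ℝ Plane) (i j k : Fin 3) (h u : ℝ) : Plane :=
  h • b i + (u • b j + (1 - h - u) • b k)

theorem coord_baryPoint (b : AffineBasis (Fin 3) ℝ Plane) {i j k : Fin 3} (hij : i ≠ j)
    (hik : i ≠ k) (hjk : j ≠ k) (h u : ℝ) :
    b.coord i (baryPoint b i j k h u) = h ∧ b.coord j (baryPoint b i j k h u) = u ∧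
      b.coord k (baryPoint b i j k h u) = 1 - h - u := by
  have key : ∀ l, b.coord l (baryPoint b i j k h u) =
      h * b.coord l (b i) + u * b.coord l (b j) + (1 - h - u) * b.coord l (b k) := by
    intro l
    have h3 := coord_smul_add b l (1 - h - u) (b k) 0
    rw [add_zero] at h3
    rw [baryPoint, coord_smul_add, coord_smul_add, h3]
    ring
  rw [key, key, key]
  simp only [b.coord_apply_eq, b.coord_apply_ne hij, b.coord_apply_ne hik, b.coord_apply_ne hjk,
    b.coord_apply_ne hij.symm, b.coord_apply_ne hik.symm, b.coord_apply_ne hjk.symm]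
  refine ⟨by ring, by ring, by ring⟩

/-- The `j`-coordinate of the point with index `l` of a chain of at most `n + 1` points. -/
noncomputable def chainLeft (y : ℝ) (n : ℕ) (δ : ℝ) (l : ℕ) : ℝ :=
  if l = 0 then 1 - y else
    -- In both cases the coordinate for the far corner is `(2 * n + 1 - 2 * l) * δ`, positive for `l
    -- ≤ n` and decreasing in `l`, and the one for the near corner increases.
    if Odd l then 1 - (2 * n + 1 - l) * δ else (2 * n + 1 - 2 * l) * δ

/-- A chain that starts on the side opposite to `b i` and continues near `b j` and `b k`. -/
noncomputable def chain (b : AffineBasis (Fin 3) ℝ Plane) (i j k : Fin 3) (y : ℝ) (n : ℕ)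
    (δ : ℝ) (l : ℕ) : Plane :=
  baryPoint b i j k (l * δ) (chainLeft y n δ l)

/-- The conditions on `δ` keep the start strictly between the points near the two corners, as the
comparisons with index 0 require. -/
theorem zigzag_chain (b : AffineBasis (Fin 3) ℝ Plane) {i j k : Fin 3} (hij : i ≠ j)
    (hik : i ≠ k) (hjk : j ≠ k) {y δ : ℝ} {n : ℕ} (hδ : 0 < δ) (hy : (2 * n + 1) * δ < y)
    (hy' : (2 * n + 1) * δ < 1 - y) : Zigzag b i j k (b i) n (chain b i j k y n δ) := by
  have hc : ∀ l, b.coord i (chain b i j k y n δ l) = l * δ ∧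
      b.coord j (chain b i j k y n δ l) = chainLeft y n δ l ∧
      b.coord k (chain b i j k y n δ l) = 1 - l * δ - chainLeft y n δ l := fun l =>
    coord_baryPoint b hij hik hjk _ _
  have h0 : chainLeft y n δ 0 = 1 - y := if_pos rfl
  have ho : ∀ l, Odd l → chainLeft y n δ l = 1 - (2 * n + 1 - l) * δ := by
    intro l hl
    have : l ≠ 0 := by
      rintro rfl
      simp at hl
    rw [chainLeft, if_neg this, if_pos hl]
  have he : ∀ l, Even l → l ≠ 0 → chainLeft y n δ l = (2 * n + 1 - 2 * l) * δ := by
    intro l hl hl0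
    rw [chainLeft, if_neg hl0, if_neg (Nat.not_odd_iff_even.2 hl)]
  have hlt : ∀ l l' : ℕ, l < l' → (l : ℝ) * δ < l' * δ := fun l l' h =>
    mul_lt_mul_of_pos_right (Nat.cast_lt.2 h) hδ
  have hle : ∀ l l' : ℕ, l ≤ l' → (l : ℝ) * δ ≤ l' * δ := fun l l' h =>
    mul_le_mul_of_nonneg_right (Nat.cast_le.2 h) hδ.le
  have hnn : ∀ l : ℕ, 0 ≤ (l : ℝ) * δ := fun l => by positivity
  constructor
  · intro l hl
    rw [(hc l).2.1, b.coord_apply_ne hij.symm]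
    have := hle l n hl
    have := hnn l
    rcases Nat.even_or_odd l with h1 | h1
    · rcases eq_or_ne l 0 with rfl | h2
      · rw [h0]
        have := hnn n
        linarith
      · rw [he l h1 h2]
        linarith
    · rw [ho l h1]
      linarith
  · intro l hl
    rw [(hc l).2.2, b.coord_apply_ne hik.symm]
    have := hle l n hl
    have := hnn l
    rcases Nat.even_or_odd l with h1 | h1
    · rcases eq_or_ne l 0 with rfl | h2
      · rw [h0, Nat.cast_zero]
        have := hnn n
        linarith
      · rw [he l h1 h2]
        linarith
    · rw [ho l h1]
      linarith
  · intro l l' h hl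
    rw [(hc l).1, (hc l').1]
    exact hlt l l' h
  · intro l l' h hl h1 h2
    rw [(hc l).2.1, (hc l').2.1, he l' h2 (by omega)]
    have := hle l' n hl
    have := hlt l l' h
    have := hnn l
    rcases eq_or_ne l 0 with rfl | h3
    · rw [h0]
      linarith
    · rw [he l h1 h3]
      linarith
  · intro l l' h hl h1 h2
    rw [(hc l).2.2, (hc l').2.2, he l' h2 (by omega)]
    have := hle l' n hl
    have := hlt l l' h
    have := hnn l
    rcases eq_or_ne l 0 with rfl | h3
    · rw [h0, Nat.cast_zero]
      linarith
    · rw [he l h1 h3]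
      linarith
  · intro l l' h hl h1 h2
    rw [(hc l).2.1, (hc l').2.1, ho l h1, ho l' h2]
    have := hlt l l' h
    linarith
  · intro l l' h hl h1 h2
    rw [(hc l).2.2, (hc l').2.2, ho l h1, ho l' h2]
    have := hlt l l' h
    linarith
  · intro l l' hl hl' h1 h2
    rw [(hc l).2.1, (hc l').2.1, ho l' h2]
    have := hle l' n hl'
    have := hle l n hl
    have := hnn l
    have := hnn l'
    rcases eq_or_ne l 0 with rfl | h3
    · rw [h0]
      linarith
    · rw [he l h1 h3]
      linarith
  · intro l l' hl hl' h1 h2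
    rw [(hc l).2.2, (hc l').2.2, ho l' h2]
    have := hle l' n hl'
    have := hle l n hl
    have := hnn l
    have := hnn l'
    rcases eq_or_ne l 0 with rfl | h3
    · rw [h0, Nat.cast_zero]
      linarith
    · rw [he l h1 h3]
      linarith

theorem continuous_chain (b : AffineBasis (Fin 3) ℝ Plane) (i j k : Fin 3) (y : ℝ) (n l : ℕ) :
    Continuous fun δ => chain b i j k y n δ l := by
  have : Continuous fun δ => chainLeft y n δ l := by
    unfold chainLeft
    split_ifs <;> fun_prop
  unfold chain baryPoint
  fun_prop

theorem chain_zero_of_odd (b : AffineBasis (Fin 3) ℝ Plane) (i j k : Fin 3) (y : ℝ) (n : ℕ)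
    {l : ℕ} (hl : Odd l) : chain b i j k y n 0 l = b j := by
  have : l ≠ 0 := by
    rintro rfl
    simp at hl
  simp [chain, baryPoint, chainLeft, this, hl]

theorem chain_zero_of_even (b : AffineBasis (Fin 3) ℝ Plane) (i j k : Fin 3) (y : ℝ) (n : ℕ)
    {l : ℕ} (hl : Even l) (hl0 : l ≠ 0) : chain b i j k y n 0 l = b k := by
  simp [chain, baryPoint, chainLeft, hl0, Nat.not_odd_iff_even.2 hl]

theorem chain_start (b : AffineBasis (Fin 3) ℝ Plane) (i : Fin 3) (y : ℝ) (n : ℕ) (δ : ℝ) :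
    chain b i (i - 1) (i + 1) y n δ 0 = b i + chord b i y := by
  simp only [chain, baryPoint, chainLeft, chord, if_true, Nat.cast_zero, zero_mul, zero_smul,
    sub_zero]
  module

/-! ### The lower bound for local algorithms -/

section LowerBound

variable {b : AffineBasis (Fin 3) ℝ Plane} {M : Type*} {A : RoutingAlgorithm M} {m : ℕ} {L : ℝ}

/-- For each small `δ` the algorithm makes one of the two detours through the chain, so the minimum
of their lengths is bounded; let `δ` tend to `0`, where odd points merge into `b (i - 1)` and even
ones into `b (i + 1)`. -/
theorem le_mul_norm_chord_of_isCompetitive (hA : A.IsCompetitive b m L) (i : Fin 3) {y : ℝ}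
    (hy₀ : 0 < y) (hy₁ : y < 1) :
    sideLen b i + min (y * sideLen b i + sideLen b (i - 1))
      ((1 - y) * sideLen b i + sideLen b (i + 1)) ≤ L * ‖chord b i y‖ := by
  obtain ⟨hij, hik, hjk⟩ := distinct_add_sub (m := -1) (Or.inr rfl) i
  rw [sub_neg_eq_add] at hik hjk
  rw [← sub_eq_add_neg] at hij hjk
  set c := chain b i (i - 1) (i + 1) y (2 * m + 4) with hc
  set s := b i + chord b i y with hs
  have hstart : ∀ δ, c δ 0 = s := chain_start b i y _
  have hcont : ∀ l, Continuous fun δ => c δ l := continuous_chain b i _ _ y _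
  set F : ℝ → ℝ := fun δ => min
    (dist s (c δ 1) + dist (c δ 1) (c δ (2 * m + 4)) + dist (c δ (2 * m + 4)) (b i))
    (dist s (c δ 2) + dist (c δ 2) (c δ (2 * m + 3)) + dist (c δ (2 * m + 3)) (b i)) with hF
  have hFc : Continuous F := by
    have h1 := hcont 1
    have h2 := hcont 2
    have h3 := hcont (2 * m + 3)
    have h4 := hcont (2 * m + 4)
    fun_prop
  have hsb : dist s (b i) = ‖chord b i y‖ := by
    rw [dist_eq_norm, hs, add_sub_cancel_left]
  have hev : ∀ᶠ δ in nhdsWithin (0 : ℝ) (Set.Ioi 0), F δ ≤ L * ‖chord b i y‖ := by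
    have hK : (0 : ℝ) < 2 * ((2 * m + 4 : ℕ) : ℝ) + 1 := by positivity
    have hpos : 0 < min y (1 - y) / (2 * ((2 * m + 4 : ℕ) : ℝ) + 1) :=
      div_pos (lt_min hy₀ (sub_pos.2 hy₁)) hK
    filter_upwards [Ioo_mem_nhdsGT hpos] with δ hδ
    have hδ' := (lt_div_iff₀' hK).1 hδ.2
    have hz := zigzag_chain b hij hik hjk (y := y) (n := 2 * m + 4) hδ.1
      (hδ'.trans_le (min_le_left _ _)) (hδ'.trans_le (min_le_right _ _))
    have := hz.le_of_isCompetitive hij hik hjk hA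
    rw [← hc, hstart, hsb] at this
    rcases this with h | h
    · exact (min_le_left _ _).trans h
    · exact (min_le_right _ _).trans h
  have hlim := le_of_tendsto ((hFc.tendsto 0).mono_left nhdsWithin_le_nhds) hev
  refine le_trans (le_of_eq ?_) hlim
  have e1 : c 0 1 = b (i - 1) := chain_zero_of_odd _ _ _ _ _ _ (by decide)
  have e2 : c 0 2 = b (i + 1) := chain_zero_of_even _ _ _ _ _ _ (by decide) (by decide)
  have e3 : c 0 (2 * m + 3) = b (i - 1) := chain_zero_of_odd _ _ _ _ _ _ (by grind)
  have e4 : c 0 (2 * m + 4) = b (i + 1) :=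
    chain_zero_of_even _ _ _ _ _ _ (by grind) (by omega)
  have d1 : dist s (b (i - 1)) = y * sideLen b i := by
    rw [sideLen_eq b hik hij hjk.symm, dist_eq_norm, dist_eq_norm]
    have : s - b (i - 1) = y • (b (i + 1) - b (i - 1)) := by
      rw [hs, chord]
      module
    rw [this, norm_smul, Real.norm_eq_abs, abs_of_pos hy₀]
  have d2 : dist s (b (i + 1)) = (1 - y) * sideLen b i := by
    rw [sideLen_eq b hij hik hjk, dist_eq_norm, dist_eq_norm]
    have : s - b (i + 1) = (1 - y) • (b (i - 1) - b (i + 1)) := by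
      rw [hs, chord]
      module
    rw [this, norm_smul, Real.norm_eq_abs, abs_of_pos (sub_pos.2 hy₁)]
  simp only [hF]
  rw [e1, e2, e3, e4, d1, d2, ← sideLen_eq b hij hik hjk, ← sideLen_eq b hik hij hjk.symm,
    ← sideLen_eq b hjk hij.symm hik.symm, ← sideLen_eq b hjk.symm hik.symm hij.symm,
    ← min_add_add_left]
  congr 1 <;> ring

theorem routingConstant_le_of_isCompetitive {θ₁ θ₂ : ℝ} (hθ : IsAngles b (angles θ₁ θ₂))
    (hA : A.IsCompetitive b m L) : routingConstant θ₁ θ₂ ≤ L := by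
  have h₁ : 0 < θ₁ := (angles_pos_lt_pi hθ 0).1
  obtain ⟨i, α, hα, hval⟩ := (isGreatest_routingConstant (θ₂ := θ₂) h₁).1
  obtain ⟨y, hy, rfl⟩ := exists_chord_angle_eq hθ i hα
  have hclosed : IsClosed {y : ℝ | sideLen b i + min (y * sideLen b i + sideLen b (i - 1))
      ((1 - y) * sideLen b i + sideLen b (i + 1)) ≤ L * ‖chord b i y‖} := by
    refine isClosed_le (by fun_prop) ?_
    unfold chord
    fun_prop
  -- The maximiser may be an end of `[0, 1]`, where no chain is available, so the bound is extended
  -- by continuity.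
  have hsub := closure_minimal (fun y (hy : y ∈ Set.Ioo (0 : ℝ) 1) =>
    le_mul_norm_chord_of_isCompetitive hA i hy.1 hy.2) hclosed
  rw [closure_Ioo zero_ne_one] at hsub
  have h : sideLen b i + min (y * sideLen b i + sideLen b (i - 1))
      ((1 - y) * sideLen b i + sideLen b (i + 1)) ≤ L * ‖chord b i y‖ := hsub hy
  rw [← (detourRatio_mul_norm_chord hθ i hy.1 hy.2).2, ← hval] at h
  exact le_of_mul_le_mul_right h (norm_pos_iff.2 (chord_ne_zero b i y))

end LowerBound

end TDRouting

/-! ### The main theorem -/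

theorem mainTheorem1 (τ : Fin 3 → Plane) (hτ : AffineIndependent ℝ τ) (θ₁ θ₂ : ℝ)
    (hθ₁ : EuclideanGeometry.angle (τ 1) (τ 0) (τ 2) = θ₁)
    (hθ₂ : EuclideanGeometry.angle (τ 2) (τ 1) (τ 0) = θ₂)
    (h₁₂ : θ₁ ≤ θ₂) (h₂₃ : θ₂ ≤ Real.pi - θ₁ - θ₂) :
    -- the explicit 1-local memoryless algorithm exists, and its routing ratio is `C(θ₁, θ₂)`
    (∃ A : TDRouting.RoutingAlgorithm Unit, A.Implements τ) ∧
    (∀ A : TDRouting.RoutingAlgorithm Unit, A.Implements τ →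
      IsLeast {c : ℝ | A.IsCompetitive τ 1 c} (TDRouting.routingConstant θ₁ θ₂) ∧
      ∀ S : Set Plane, S.Finite → TDRouting.GeneralPosition τ S → ∀ s ∈ S, ∀ t ∈ S,
        ((∃ i, t ∈ TDRouting.negCone τ s i) →
          A.RoutesWithin (TDRouting.tdGraph τ S) 1 s t
            (TDRouting.routingConstant θ₁ θ₂ * dist s t)) ∧
        ((∃ i, t ∈ TDRouting.posCone τ s i) →
          A.RoutesWithin (TDRouting.tdGraph τ S) 1 s t
            (1 / Real.sin (θ₁ / 2) * dist s t))) ∧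
    -- no `k`-local algorithm, with whatever memory, has a smaller routing ratio
    (∀ (k : ℕ), 1 ≤ k → ∀ (M : Type*) (A : TDRouting.RoutingAlgorithm M) (c : ℝ),
      A.IsCompetitive τ k c → TDRouting.routingConstant θ₁ θ₂ ≤ c) := by
  obtain ⟨b, rfl⟩ : ∃ b : AffineBasis (Fin 3) ℝ Plane, ⇑b = τ :=
    ⟨⟨τ, hτ, hτ.affineSpan_eq_top_iff_card_eq_finrank_add_one.2 (by simp)⟩, rfl⟩
  have hθ : TDRouting.IsAngles b (TDRouting.angles θ₁ θ₂) := by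
    have h := EuclideanGeometry.angle_add_angle_add_angle_eq_pi (b 2)
      (b.ind.injective.ne (by decide : (1 : Fin 3) ≠ 0))
    intro i
    fin_cases i
    · exact hθ₁.symm
    · exact hθ₂.symm
    · change Real.pi - θ₁ - θ₂ = EuclideanGeometry.angle (b 0) (b 2) (b 1)
      rw [EuclideanGeometry.angle_comm (b 0) (b 1) (b 2), hθ₂,
        EuclideanGeometry.angle_comm (b 2) (b 0) (b 1), hθ₁,
        EuclideanGeometry.angle_comm (b 1) (b 2) (b 0)] at h
      linarith
  have h₁ : 0 < θ₁ := (TDRouting.angles_pos_lt_pi hθ 0).1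
  refine ⟨TDRouting.exists_implements b, fun A hA => ?_, fun _ _ _ _ _ hA =>
    TDRouting.routingConstant_le_of_isCompetitive hθ hA⟩
  have hneg : ∀ S : Set Plane, S.Finite → TDRouting.GeneralPosition b S → ∀ s ∈ S, ∀ t ∈ S,
      (∃ i, t ∈ TDRouting.negCone b s i) → A.RoutesWithin (TDRouting.tdGraph b S) 1 s t
        (TDRouting.routingConstant θ₁ θ₂ * dist s t) := by
    rintro S hS hG s hs t ht ⟨i, hi⟩
    exact (TDRouting.Good.of_negCone hθ h₁ i fun l hl =>
      TDRouting.coord_lt_of_mem_negCone hG hs ht hi hl).routesWithin hS hG hA hs ht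
  have hpos : ∀ S : Set Plane, S.Finite → TDRouting.GeneralPosition b S → ∀ s ∈ S, ∀ t ∈ S,
      (∃ i, t ∈ TDRouting.posCone b s i) → A.RoutesWithin (TDRouting.tdGraph b S) 1 s t
        (1 / Real.sin (θ₁ / 2) * dist s t) := by
    rintro S hS hG s hs t ht ⟨i, hi⟩
    exact (TDRouting.Good.of_posCone hθ h₁₂ h₂₃ i fun l hl =>
      TDRouting.coord_lt_of_mem_posCone hG hs ht hi hl).routesWithin hS hG hA hs ht
  refine ⟨⟨fun S hS hG s hs t ht => ?_, fun c hc =>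
    TDRouting.routingConstant_le_of_isCompetitive hθ hc⟩,
    fun S hS hG s hs t ht => ⟨hneg S hS hG s hs t ht, hpos S hS hG s hs t ht⟩⟩
  rcases eq_or_ne s t with rfl | hst
  -- For `s = t` the path has no edges.
  · exact ⟨0, rfl, fun i hi => absurd hi (Nat.not_lt_zero i), by simp⟩
  rcases TDRouting.exists_mem_cone b hst with h | h
  · exact hneg S hS hG s hs t ht h
  · obtain ⟨n, h1, h2, h3⟩ := hpos S hS hG s hs t ht h
    exact ⟨n, h1, h2, h3.trans (mul_le_mul_of_nonneg_right
      (TDRouting.one_div_sin_le_routingConstant hθ h₂₃) dist_nonneg)⟩
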